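/- \textbf{Setting.} Fix a radius $R>0$. For integers $k,d\ge 1$ let $$\mathcal G_{k,d}=\Big\{\Gamma=\sum_{j=1}^k w_j\delta_{\mu_j}:\ \mu_j\in\mathbb R^d,\ \|\mu_j\|_2\le R,\ w_j\ge 0,\ \sum_{j=1}^k w_j=1\Big\},\qquad P_\Gamma=\Gamma*N(0,I_d).$$ Let $H(P,Q)=\big(\int(\sqrt p-\sqrt q)^2\,d\mu\big)^{1/2}$ be the Hellinger distance ($p,q$ the densities with respect to a dominating measure $\mu$) and $W_1(\Gamma,\Gamma')=\inf\mathbb E\|U-U'\|_2$ the Wasserstein distance (infimum over all couplings $U\sim\Gamma$, $U'\sim\Gamma'$). An estimator of the mixing distribution is a measurable map from samples to $\mathcal G_{k,d}$; a proper density estimator is one of the form $\hat P=P_{\tilde\Gamma}$ with $\tilde\Gamma$ such a map. \textbf{Theorem.} There is a constant $C>0$ depending only on $R$ such that the following holds for all $k\ge1$ and $c_k>0$. For $d,n\ge 1$ write $$\rho(d,n)=(Ck)^{k/2}\sqrt{c_k}\Big(\frac dn\Big)^{1/4}+C\,k^{5}\,c_k^{\frac1{2k-1}}\Big(\frac1n\Big)^{\frac1{4k-2}}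 .$$ (a) Let $n\ge1$ and suppose that for each $d\ge1$ there is a proper density estimator $\hat P_d=P_{\tilde\Gamma_d}$ such that for every $\Gamma\in\mathcal G_{k,d}$ and $X_1,\dots,X_n\overset{\text{i.i.d.}}{\sim}P_\Gamma$, $$\mathbb E\,H\big(\hat P_d(X_1,\dots,X_n),P_\Gamma\big)\le c_k\sqrt{d/n}.\qquad(*)$$ Then for each $d\ge1$ there is an estimator $\hat\Gamma\in\mathcal G_{k,d}$ based on $X_1,\dots,X_{2n}\overset{\text{i.i.d.}}{\sim}P_\Gamma$ with $\mathbb E\,W_1(\hat\Gamma,\Gamma)\le\rho(d,n)$ for every $\Gamma\in\mathcal G_{k,d}$. It is built in two stages. With $r=\min(d,k)$, there is a $d\times r$ matrix $\hat V$ with orthonormal columns, a measurable function of $X_1,\dots,X_n$, whose column span contains the atoms of $\tilde\Gamma_d(X_1,\dots,X_n)$; and $\hat\Gamma$ is the image under $z\mapsto\hat Vz$ of $\hat\gamma=\tilde\Gamma_r(\hat V^\top X_{n+1},\dots,\hat V^\top X_{2n})$. (b) Suppose that such proper density estimators, satisfying $(*)$ with the same $c_k$, exist for all $d\ge1$ and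 all $n\ge1$. Then for all $n,d\ge1$ there is an estimator $\hat\Gamma\in\mathcal G_{k,d}$ based on $n$ observations $X_1,\dots,X_n\overset{\text{i.i.d.}}{\sim}P_\Gamma$ with $\mathbb E\,W_1(\hat\Gamma,\Gamma)\le\rho(d,n)$ for every $\Gamma\in\mathcal G_{k,d}$; for $n\ge2$ it is obtained by the two-stage construction of (a) from the density estimators for sample size $\lfloor n/2\rfloor$, applied to the first and the next $\lfloor n/2\rfloor$ observations. -/

import Mathlib

open MeasureTheory ProbabilityTheory
open scoped ENNReal

noncomputable section

/-- Euclidean space `ℝ^d`. -/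
abbrev Euc (d : ℕ) : Type := EuclideanSpace ℝ (Fin d)

/-- The class `G_{k,d}` of mixing distributions: `∑_{j ≤ k} w_j δ_{μ_j}` with `‖μ_j‖ ≤ R`,
`w_j ≥ 0`, `∑ w_j = 1` (atoms may coincide, weights may vanish). -/
def atomicMixing (k d : ℕ) (R : ℝ) : Set (Measure (Euc d)) :=
  {Γ | ∃ (w : Fin k → ℝ) (μ : Fin k → Euc d),
    (∀ j, ‖μ j‖ ≤ R) ∧ (∀ j, 0 ≤ w j) ∧ ∑ j, w j = 1 ∧
      Γ = ∑ j, ENNReal.ofReal (w j) • Measure.dirac (μ j)}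

/-- The Gaussian mixture `P_Γ = Γ * N(0, I_d)`. -/
def gaussMix {d : ℕ} (Γ : Measure (Euc d)) : Measure (Euc d) :=
  Γ.conv (stdGaussian (Euc d))

/-- The law of `n` i.i.d. observations from `P_Γ`. -/
def sampleLaw {d : ℕ} (n : ℕ) (Γ : Measure (Euc d)) : Measure (Fin n → Euc d) :=
  Measure.pi (fun _ : Fin n => gaussMix Γ)

/-- The Hellinger distance `(∫ (√p - √q)² dμ)^{1/2}`, with densities taken with respect to the
dominating measure `μ = P + Q`. -/
def hellinger {α : Type*} [MeasurableSpace α] (P Q : Measure α) : ℝ≥0∞ :=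
  (∫⁻ x, ENNReal.ofReal
    ((√(P.rnDeriv (P + Q) x).toReal - √(Q.rnDeriv (P + Q) x).toReal) ^ 2) ∂(P + Q)) ^ (1 / 2 : ℝ)

/-- The `1`-Wasserstein distance: the infimum of `E ‖U - U'‖` over all couplings. -/
def wasserstein1 {d : ℕ} (Γ Γ' : Measure (Euc d)) : ℝ≥0∞ :=
  ⨅ π ∈ {π : Measure (Euc d × Euc d) | π.map Prod.fst = Γ ∧ π.map Prod.snd = Γ'},
    ∫⁻ p, edist p.1 p.2 ∂π

/-- An estimator, from `n` observations in `ℝ^d`, of the mixing distribution, with values in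
`G_{k,d}`. The associated mixture `gaussMix (G X)` is a proper density estimator. -/
structure IsMixingEstimator (k d n : ℕ) (R : ℝ)
    (G : (Fin n → Euc d) → Measure (Euc d)) : Prop where
  measurable : Measurable G
  mem : ∀ X, G X ∈ atomicMixing k d R

/-- `gaussMix (G X)` is a proper density estimator, from `n` observations in `ℝ^d`, whose expected
Hellinger error is at most `c (d/n)^{1/2}`, uniformly over `G_{k,d}`. -/
structure IsProperDensityEstimator (k d n : ℕ) (R c : ℝ)
    (G : (Fin n → Euc d) → Measure (Euc d)) : Prop where
  estimator : IsMixingEstimator k d n R G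
  risk : ∀ Γ ∈ atomicMixing k d R,
    ∫⁻ X, hellinger (gaussMix (G X)) (gaussMix Γ) ∂(sampleLaw n Γ)
      ≤ ENNReal.ofReal (c * ((d : ℝ) / n) ^ (1 / 2 : ℝ))

/-- The right-hand side of the risk bound. -/
def mixingRate (C c : ℝ) (k d n : ℕ) : ℝ :=
  (C * k) ^ ((k : ℝ) / 2) * √c * ((d : ℝ) / n) ^ (1 / 4 : ℝ)
    + C * (k : ℝ) ^ 5 * c ^ (1 / (2 * (k : ℝ) - 1)) * (1 / (n : ℝ)) ^ (1 / (4 * (k : ℝ) - 2))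

/-- `E W₁(G, Γ)` is at most `b`, uniformly over `G_{k,d}`. -/
def HasW1Risk (k d n : ℕ) (R b : ℝ) (G : (Fin n → Euc d) → Measure (Euc d)) : Prop :=
  ∀ Γ ∈ atomicMixing k d R,
    ∫⁻ X, wasserstein1 (G X) Γ ∂(sampleLaw n Γ) ≤ ENNReal.ofReal b

/-- For a matrix `V` with columns `V j`, the vector `Vᵀ y`. -/
def projFrame {d r : ℕ} (V : Fin r → Euc d) (y : Euc d) : Euc r :=
  WithLp.toLp 2 (fun j => inner ℝ (V j) y)

/-- For a matrix `V` with columns `V j`, the vector `V z`. -/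
def liftFrame {d r : ℕ} (V : Fin r → Euc d) (z : Euc r) : Euc d :=
  ∑ j, z j • V j

/-- The first `m` observations. -/
def firstHalf {d m N : ℕ} (h : 2 * m ≤ N) (X : Fin N → Euc d) : Fin m → Euc d :=
  fun i => X ⟨i, by omega⟩

/-- The observations numbered `m + 1, …, 2 m`. -/
def secondHalf {d m N : ℕ} (h : 2 * m ≤ N) (X : Fin N → Euc d) : Fin m → Euc d :=
  fun i => X ⟨m + i, by omega⟩

/-- `G` is the two-stage estimator built from the `m`-sample density estimators
`gaussMix (F d' ·)`, `d' = 1, 2, …`. The density estimator in `ℝ^d` is applied to the first `m`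
observations, and `V` is an orthonormal frame of `r = min d k` vectors whose span contains the
atoms of the fitted mixing distribution. The next `m` observations are projected to `ℝ^r` by `Vᵀ`,
the density estimator in `ℝ^r` is applied to them, and the mixing distribution that it yields is
mapped back to `ℝ^d` by `V`. -/
def IsTwoStage (k : ℕ) {d m N : ℕ} (h : 2 * m ≤ N)
    (F : (d' : ℕ) → (Fin m → Euc d') → Measure (Euc d'))
    (G : (Fin N → Euc d) → Measure (Euc d)) : Prop :=
  ∃ V : (Fin m → Euc d) → Fin (min d k) → Euc d,
    Measurable V ∧
    (∀ x, Orthonormal ℝ (V x)) ∧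
    (∀ x, F d x ((Submodule.span ℝ (Set.range (V x)) : Set (Euc d))ᶜ) = 0) ∧
    ∀ X, G X = (F (min d k) (fun i => projFrame (V (firstHalf h X)) (secondHalf h X i))).map
      (liftFrame (V (firstHalf h X)))

end

/-! The estimation error splits into the part orthogonal to the estimated subspace and the part
inside it. Both are controlled by one test function: integrating `exp ⟨s, x⟩` against a Gaussian
mixture gives the Laplace transform of its mixing distribution up to a known factor. Cauchy–Schwarz
then shows that for `‖s‖ ≤ 1` two Laplace transforms differ by at most a constant depending only on
`R` times the Hellinger distance (`abs_laplace_sub_le_hellinger`).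

Orthogonal part: the fitted distribution lives on the span of the frame, so its transform is 1 at
every `s` orthogonal to the span. Since `2 + x² ≤ eˣ + e⁻ˣ`, comparing at `±u` bounds the true
second moment along a unit `u` by a multiple of the Hellinger error, with no dependence on `d`
(`sum_mul_norm_frameResidual_le`). The mean distance to the span is thus of the order of the square
root of the Hellinger error, which gives `(d/n)^{1/4}`.

Inside part: given the first half, the projected second half is an i.i.d. sample from a mixture in
dimension `r ≤ k`. A Gaussian direction `u` nearly preserves all `k²` differences of atoms
(`exists_direction`), which reduces transport to the line. There the Laplace transforms at `(m / 2k)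
u`, `m < 2k`, are ordinary moments of the nodes `exp(⟨u, μ⟩ / 2k)`. At most `2k` nodes with close
moments have close distribution functions across every gap (`abs_sum_left_le_of_moments`), and the
monotone coupling adds up the gaps. The cost is of order `H^{1/(2k-1)}`
(`exists_coupling_le_hellinger`).

Jensen moves both concave powers outside the expectation. The frame is chosen measurably from the
second moment matrix of the fit, whose columns span the atoms of positive mass. In (b) a single
observation cannot be split; there a trivial estimator suffices, because a two-point argument bounds
the risk constant from below in terms of `R` alone. -/

/-! ### Moment comparison on the line -/

/-- A signed weight family with small moments has small mass on the left of a gap of length `g`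
between its nodes. -/
theorem abs_sum_left_le_of_moments {ι : Type*} [DecidableEq ι] (y : ι → ℝ) {K g : ℝ} (hg : 0 < g)
    (hgK : g ≤ 2 * K) (hK : ∀ i, 1 + |y i| ≤ K) (N : ℕ) :
    ∀ (A B : Finset ι) (s : ι → ℝ) (δ : ℝ),
      (∀ a ∈ A, ∀ b ∈ B, g ≤ y b - y a) → A.card + B.card ≤ N + 1 →
      (∀ m ≤ N, |∑ i ∈ A, s i * y i ^ m + ∑ i ∈ B, s i * y i ^ m| ≤ δ) →
      |∑ i ∈ A, s i| ≤ δ * (2 * K / g) ^ N := by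
  have h1 : 1 ≤ 2 * K / g := by rwa [one_le_div hg]
  induction N with
  | zero =>
    intro A B s δ hAB hcard hm
    have h0 := hm 0 le_rfl
    rcases A.eq_empty_or_nonempty with rfl | hA
    · simpa using (abs_nonneg _).trans h0
    · have : B = ∅ := by
        have := hA.card_pos
        rw [← Finset.card_eq_zero]; omega
      subst this
      simpa using h0
  | succ N ih =>
    intro A B s δ hAB hcard hm
    have h0 := hm 0 (Nat.zero_le _)
    have hδ : 0 ≤ δ := (abs_nonneg _).trans h0
    rcases A.eq_empty_or_nonempty with rfl | ⟨a, ha⟩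
    · simp only [Finset.sum_empty, abs_zero]
      positivity
    rcases B.eq_empty_or_nonempty with rfl | ⟨b, hb⟩
    · simp only [pow_zero, mul_one, Finset.sum_empty, add_zero] at h0
      exact h0.trans (le_mul_of_one_le_right hδ (one_le_pow₀ h1))
    have hgap := hAB a ha b hb
    -- Multiplying the weights by `y - y c` removes the node `c` at the cost of one moment and a
    -- factor `K`.
    have hmom : ∀ c : ι, ∀ m ≤ N,
        |∑ i ∈ A, s i * (y i - y c) * y i ^ m + ∑ i ∈ B, s i * (y i - y c) * y i ^ m|
          ≤ δ * K := by
      intro c m hmN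
      have e : ∑ i ∈ A, s i * (y i - y c) * y i ^ m + ∑ i ∈ B, s i * (y i - y c) * y i ^ m
          = (∑ i ∈ A, s i * y i ^ (m + 1) + ∑ i ∈ B, s i * y i ^ (m + 1))
            - y c * (∑ i ∈ A, s i * y i ^ m + ∑ i ∈ B, s i * y i ^ m) := by
        simp only [mul_add, Finset.mul_sum]
        rw [add_sub_add_comm, ← Finset.sum_sub_distrib, ← Finset.sum_sub_distrib]
        congr 1 <;> exact Finset.sum_congr rfl fun i _ => by ring
      rw [e]
      calc _ ≤ δ + |y c| * δ := by
            refine (abs_sub _ _).trans (add_le_add (hm _ (by omega)) ?_)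
            rw [abs_mul]
            exact mul_le_mul_of_nonneg_left (hm m (by omega)) (abs_nonneg _)
        _ = δ * (1 + |y c|) := by ring
        _ ≤ δ * K := mul_le_mul_of_nonneg_left (hK c) hδ
    have e1 : ∀ (S : Finset ι) (c : ι) (m : ℕ), ∑ i ∈ S.erase c, s i * (y i - y c) * y i ^ m
        = ∑ i ∈ S, s i * (y i - y c) * y i ^ m := fun S c m =>
      Finset.sum_erase _ (by simp)
    have i1 := ih (A.erase a) B (fun i => s i * (y i - y a)) (δ * K)
      (fun a' ha' b' hb' => hAB a' (Finset.mem_of_mem_erase ha') b' hb')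
      (by have := Finset.card_erase_add_one ha; omega)
      (fun m hmN => by rw [e1]; exact hmom a m hmN)
    have i2 := ih A (B.erase b) (fun i => s i * (y i - y b)) (δ * K)
      (fun a' ha' b' hb' => hAB a' ha' b' (Finset.mem_of_mem_erase hb'))
      (by have := Finset.card_erase_add_one hb; omega)
      (fun m hmN => by rw [e1]; exact hmom b m hmN)
    have e2 : ∑ i ∈ A.erase a, s i * (y i - y a) = ∑ i ∈ A, s i * (y i - y a) :=
      Finset.sum_erase _ (by simp)
    rw [e2] at i1
    -- The two reductions, at a node `a` on the left and a node `b` on the right, differ on `A` by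
    -- exactly `(y b - y a)` times the mass sought; dividing by the gap gives the factor `2K / g`.
    have e3 : (y b - y a) * ∑ i ∈ A, s i
        = ∑ i ∈ A, s i * (y i - y a) - ∑ i ∈ A, s i * (y i - y b) := by
      rw [Finset.mul_sum, ← Finset.sum_sub_distrib]
      exact Finset.sum_congr rfl fun i _ => by ring
    have e4 : (y b - y a) * |∑ i ∈ A, s i| ≤ 2 * (δ * K * (2 * K / g) ^ N) := by
      rw [← abs_of_pos (hg.trans_le hgap), ← abs_mul, e3]
      exact (abs_sub _ _).trans (by linarith)
    have e5 : g * |∑ i ∈ A, s i| ≤ 2 * (δ * K * (2 * K / g) ^ N) :=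
      (mul_le_mul_of_nonneg_right hgap (abs_nonneg _)).trans e4
    rw [mul_comm, ← le_div_iff₀ hg] at e5
    refine e5.trans (le_of_eq ?_)
    rw [pow_succ]; ring

/-! ### Monotone couplings and transport cost on the line -/

/-- `π` couples the weights `w` on `A` and `v` on `B`; for every threshold `t` the mass of pairs
that `t` separates is at most the difference of the distribution functions. -/
structure IsMonotoneCoupling {ι : Type*} (A B : Finset ι) (w v a b : ι → ℝ) (π : ι → ι → ℝ) :
    Prop where
  nonneg : ∀ i j, 0 ≤ π i j
  row : ∀ i ∈ A, ∑ j ∈ B, π i j = w i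
  col : ∀ j ∈ B, ∑ i ∈ A, π i j = v j
  sep : ∀ t : ℝ, ∑ i ∈ A, ∑ j ∈ B,
      π i j * |(if a i ≤ t then (1 : ℝ) else 0) - (if b j ≤ t then 1 else 0)|
    ≤ |∑ i ∈ A, (if a i ≤ t then w i else 0) - ∑ j ∈ B, (if b j ≤ t then v j else 0)|

theorem IsMonotoneCoupling.symm {ι : Type*} {A B : Finset ι} {w v a b : ι → ℝ} {π : ι → ι → ℝ}
    (h : IsMonotoneCoupling A B w v a b π) :
    IsMonotoneCoupling B A v w b a (fun j i => π i j) where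
  nonneg i j := h.nonneg j i
  row := h.col
  col := h.row
  sep t := by
    rw [Finset.sum_comm, abs_sub_comm]
    refine le_trans (le_of_eq ?_) (h.sep t)
    exact Finset.sum_congr rfl fun i _ => Finset.sum_congr rfl fun j _ => by rw [abs_sub_comm]

open Classical in
/-- Matching the lowest atom of `A` with the lowest atom of `B`. -/
theorem IsMonotoneCoupling.extend {ι : Type*} {A B : Finset ι} {w v a b : ι → ℝ}
    {π : ι → ι → ℝ} {p q : ι} (hp : p ∈ A) (hq : q ∈ B)
    (hw : ∀ i ∈ A, 0 ≤ w i) (hv : ∀ j ∈ B, 0 ≤ v j)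
    (hpa : ∀ i ∈ A, a p ≤ a i) (hqb : ∀ j ∈ B, b q ≤ b j) (hpq : w p ≤ v q)
    (h : IsMonotoneCoupling (A.erase p) B w (Function.update v q (v q - w p)) a b π) :
    IsMonotoneCoupling A B w v a b
      (fun i j => if i = p then (if j = q then w p else 0) else π i j) := by
  have hsplitA : ∀ f : ι → ℝ, ∑ i ∈ A, f i = f p + ∑ i ∈ A.erase p, f i := fun f =>
    (Finset.add_sum_erase A f hp).symm
  have herase : ∀ f g : ι → ℝ, ∑ i ∈ A.erase p, (if i = p then f i else g i)
      = ∑ i ∈ A.erase p, g i := fun f g =>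
    Finset.sum_congr rfl fun i hi => if_neg (Finset.ne_of_mem_erase hi)
  refine ⟨?_, ?_, ?_, ?_⟩
  · intro i j
    split_ifs
    · exact hw p hp
    · exact le_rfl
    · exact h.nonneg i j
  · intro i hi
    by_cases hip : i = p
    · subst hip; simp [hq]
    · simpa [hip] using h.row i (Finset.mem_erase.2 ⟨hip, hi⟩)
  · intro j hj
    rw [hsplitA, herase, h.col j hj]
    by_cases hjq : j = q
    · subst hjq; simp
    · simp [hjq]
  · intro t
    have e1 : ∑ i ∈ A, ∑ j ∈ B, (if i = p then (if j = q then w p else 0) else π i j)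
          * |(if a i ≤ t then (1 : ℝ) else 0) - (if b j ≤ t then 1 else 0)|
        = w p * |(if a p ≤ t then (1 : ℝ) else 0) - (if b q ≤ t then 1 else 0)|
          + ∑ i ∈ A.erase p, ∑ j ∈ B, π i j
          * |(if a i ≤ t then (1 : ℝ) else 0) - (if b j ≤ t then 1 else 0)| := by
      rw [hsplitA]
      congr 1
      · simp only [if_true]
        rw [Finset.sum_eq_single q]
        · simp
        · intro j _ hjq; simp [hjq]
        · intro hq'; exact absurd hq hq'
      · refine Finset.sum_congr rfl fun i hi => ?_
        simp [Finset.ne_of_mem_erase hi]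
    have e2 : ∑ i ∈ A, (if a i ≤ t then w i else 0)
        = (if a p ≤ t then w p else 0) + ∑ i ∈ A.erase p, (if a i ≤ t then w i else 0) :=
      hsplitA _
    have e3 : ∑ j ∈ B, (if b j ≤ t then v j else 0)
        = (if b q ≤ t then w p else 0)
          + ∑ j ∈ B, (if b j ≤ t then Function.update v q (v q - w p) j else 0) := by
      rw [← Finset.add_sum_erase B _ hq, ← Finset.add_sum_erase B
        (fun j => if b j ≤ t then Function.update v q (v q - w p) j else 0) hq]
      have : ∑ j ∈ B.erase q, (if b j ≤ t then Function.update v q (v q - w p) j else 0)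
          = ∑ j ∈ B.erase q, (if b j ≤ t then v j else 0) :=
        Finset.sum_congr rfl fun j hj => by
          rw [Function.update_of_ne (Finset.ne_of_mem_erase hj)]
      rw [this, Function.update_self]
      split_ifs <;> ring
    have hs := h.sep t
    have hwp := hw p hp
    have hA0 : 0 ≤ ∑ i ∈ A.erase p, (if a i ≤ t then w i else 0) :=
      Finset.sum_nonneg fun i hi => by
        split_ifs
        · exact hw i (Finset.mem_of_mem_erase hi)
        · exact le_rfl
    have hB0 : 0 ≤ ∑ j ∈ B, (if b j ≤ t then Function.update v q (v q - w p) j else 0) :=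
      Finset.sum_nonneg fun j hj => by
        split_ifs
        · by_cases hjq : j = q
          · subst hjq; simpa using hpq
          · rw [Function.update_of_ne hjq]; exact hv j hj
        · exact le_rfl
    -- Minimality of `p` and `q` enters here: if `t` separates `a p` from `b q`, one side has no
    -- mass up to `t`, so the mass `w p` of the matched pair adds to the difference of the
    -- distribution functions without cancellation.
    have hAz : ¬ a p ≤ t → ∑ i ∈ A.erase p, (if a i ≤ t then w i else 0) = 0 := fun hap =>
      Finset.sum_eq_zero fun i hi => if_neg fun hit =>
        hap ((hpa i (Finset.mem_of_mem_erase hi)).trans hit)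
    have hBz : ¬ b q ≤ t →
        ∑ j ∈ B, (if b j ≤ t then Function.update v q (v q - w p) j else 0) = 0 := fun hbq =>
      Finset.sum_eq_zero fun j hj => if_neg fun hjt => hbq ((hqb j hj).trans hjt)
    rw [e1, e2, e3]
    generalize ∑ i ∈ A.erase p, (if a i ≤ t then w i else 0) = SA at *
    generalize ∑ j ∈ B, (if b j ≤ t then Function.update v q (v q - w p) j else 0) = SB at *
    by_cases hap : a p ≤ t <;> by_cases hbq : b q ≤ t
    · simpa [hap, hbq] using hs
    · have := hBz hbq
      subst this
      rw [sub_zero, abs_of_nonneg hA0] at hs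
      simp only [hap, hbq, if_true, if_false, sub_zero, abs_one, mul_one, add_zero]
      rw [abs_of_nonneg (by positivity)]
      linarith
    · have := hAz hap
      subst this
      rw [zero_sub, abs_neg, abs_of_nonneg hB0] at hs
      simp only [hap, hbq, if_true, if_false, zero_sub, abs_neg, abs_one, mul_one, add_zero]
      rw [abs_of_nonneg (by positivity)]
      linarith
    · simpa [hap, hbq] using hs

-- Greedy matching from the left: the lighter of the two lowest atoms is exhausted and removed, so
-- the number of atoms drops by one.
open Classical in
theorem exists_isMonotoneCoupling_aux {ι : Type*} (a b : ι → ℝ) (n : ℕ) :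
    ∀ (A B : Finset ι) (w v : ι → ℝ), A.card + B.card = n → (∀ i ∈ A, 0 ≤ w i) →
      (∀ j ∈ B, 0 ≤ v j) → ∑ i ∈ A, w i = ∑ j ∈ B, v j →
      ∃ π, IsMonotoneCoupling A B w v a b π := by
  induction n generalizing a b with
  | zero =>
    intro A B w v hn _ _ _
    obtain ⟨rfl, rfl⟩ : A = ∅ ∧ B = ∅ := by
      constructor <;> rw [← Finset.card_eq_zero] <;> omega
    exact ⟨0, by simp, by simp, by simp, by simp⟩
  | succ n ih =>
    intro A B w v hn hw hv hwv
    rcases A.eq_empty_or_nonempty with rfl | hA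
    · have hz : ∀ j ∈ B, v j = 0 := (Finset.sum_eq_zero_iff_of_nonneg hv).1 (by simpa using hwv.symm)
      refine ⟨0, by simp, by simp, fun j hj => by simp [hz j hj], fun t => ?_⟩
      simp
    rcases B.eq_empty_or_nonempty with rfl | hB
    · have hz : ∀ i ∈ A, w i = 0 := (Finset.sum_eq_zero_iff_of_nonneg hw).1 (by simpa using hwv)
      refine ⟨0, by simp, fun i hi => by simp [hz i hi], by simp, fun t => ?_⟩
      simp
    obtain ⟨p, hp, hpa⟩ := A.exists_min_image a hA
    obtain ⟨q, hq, hqb⟩ := B.exists_min_image b hB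
    -- Everything is quantified anew so that the case `v q ≤ w p` follows by exchanging the two
    -- sides.
    have key : ∀ (a b : ι → ℝ) (A B : Finset ι) (w v : ι → ℝ) (p q : ι), A.card + B.card = n + 1 →
        (∀ i ∈ A, 0 ≤ w i) → (∀ j ∈ B, 0 ≤ v j) → ∑ i ∈ A, w i = ∑ j ∈ B, v j → p ∈ A → q ∈ B →
        (∀ i ∈ A, a p ≤ a i) → (∀ j ∈ B, b q ≤ b j) → w p ≤ v q →
        ∃ π, IsMonotoneCoupling A B w v a b π := by
      intro a b A B w v p q hn hw hv hwv hp hq hpa hqb hpq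
      obtain ⟨π, hπ⟩ := ih a b (A.erase p) B w (Function.update v q (v q - w p))
        (by have := Finset.card_erase_add_one hp; omega)
        (fun i hi => hw i (Finset.mem_of_mem_erase hi))
        (fun j hj => by
          by_cases hjq : j = q
          · subst hjq; simpa using hpq
          · rw [Function.update_of_ne hjq]; exact hv j hj)
        (by
          rw [Finset.sum_update_of_mem hq, ← Finset.erase_eq]
          have h1 := Finset.add_sum_erase A w hp
          have h2 := Finset.add_sum_erase B v hq
          linarith)
      exact ⟨_, hπ.extend hp hq hw hv hpa hqb hpq⟩
    rcases le_total (w p) (v q) with hpq | hpq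
    · exact key a b A B w v p q hn hw hv hwv hp hq hpa hqb hpq
    · obtain ⟨π, hπ⟩ := key b a B A v w q p (by omega) hv hw hwv.symm hq hp hqb hpa hpq
      exact ⟨_, hπ.symm⟩

theorem exists_isMonotoneCoupling {ι : Type*} (a b : ι → ℝ) (A B : Finset ι) (w v : ι → ℝ)
    (hw : ∀ i ∈ A, 0 ≤ w i) (hv : ∀ j ∈ B, 0 ≤ v j) (hwv : ∑ i ∈ A, w i = ∑ j ∈ B, v j) :
    ∃ π, IsMonotoneCoupling A B w v a b π :=
  exists_isMonotoneCoupling_aux a b _ A B w v rfl hw hv hwv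

/-- The distance of two points of a chain is at most the total length of the gaps that separate
them. -/
theorem Monotone.abs_sub_le_sum_gaps {z : ℕ → ℝ} (hz : Monotone z) {M p q : ℕ} (hp : p ≤ M)
    (hq : q ≤ M) :
    |z p - z q| ≤ ∑ r ∈ Finset.range M, (z (r + 1) - z r) *
      |(if z p ≤ z r then (1 : ℝ) else 0) - (if z q ≤ z r then 1 else 0)| := by
  wlog hpq : p ≤ q generalizing p q
  · rw [abs_sub_comm]
    refine (this hq hp (le_of_not_ge hpq)).trans (le_of_eq ?_)
    exact Finset.sum_congr rfl fun r _ => by rw [abs_sub_comm]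
  have hnn : ∀ r, 0 ≤ z (r + 1) - z r := fun r => sub_nonneg.2 (hz r.le_succ)
  calc |z p - z q| = ∑ r ∈ Finset.Ico p q, (z (r + 1) - z r) := by
        rw [Finset.sum_Ico_sub z hpq, abs_sub_comm, abs_of_nonneg (sub_nonneg.2 (hz hpq))]
    _ ≤ ∑ r ∈ Finset.Ico p q, (z (r + 1) - z r) *
      |(if z p ≤ z r then (1 : ℝ) else 0) - (if z q ≤ z r then 1 else 0)| := by
        refine Finset.sum_le_sum fun r hr => ?_
        obtain ⟨h1, h2⟩ := Finset.mem_Ico.1 hr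
        rw [if_pos (hz h1)]
        split_ifs with h
        -- A gap below `q` that fails to separate has length zero, because the chain may repeat
        -- values.
        · have := hz (Nat.succ_le_of_lt h2)
          simp only [Nat.succ_eq_add_one] at this
          have := hnn r
          simp only [sub_self, abs_zero, mul_zero]
          linarith
        · simp
    _ ≤ _ := by
        refine Finset.sum_le_sum_of_subset_of_nonneg ?_ fun r _ _ =>
          mul_nonneg (hnn r) (abs_nonneg _)
        intro r hr
        simp only [Finset.mem_Ico, Finset.mem_range] at hr ⊢
        omega

/-- Finitely many reals are the values of a chain. -/
theorem exists_monotone_enumeration {n : ℕ} (hn : 0 < n) (f : Fin n → ℝ) :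
    ∃ z : ℕ → ℝ, Monotone z ∧ (∀ r, ∃ i, z r = f i) ∧ ∀ i, ∃ p ≤ n - 1, f i = z p := by
  let σ := Tuple.sort f
  -- The sorted list is continued by its last value.
  refine ⟨fun r => f (σ ⟨min r (n - 1), by omega⟩), ?_, fun r => ⟨_, rfl⟩, fun i => ?_⟩
  · intro r s hrs
    apply Tuple.monotone_sort f
    simp only [Fin.mk_le_mk]
    omega
  · refine ⟨σ.symm i, by omega, ?_⟩
    have : (⟨min (σ.symm i) (n - 1), by omega⟩ : Fin n) = σ.symm i := Fin.ext (by simp; omega)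
    simp only [this, Equiv.apply_symm_apply]

/-- The weights `π` couple `w` and `v`. -/
structure IsWeightCoupling {ι : Type*} [Fintype ι] (w v : ι → ℝ) (π : ι → ι → ℝ) : Prop where
  nonneg : ∀ i j, 0 ≤ π i j
  row : ∀ i, ∑ j, π i j = w i
  col : ∀ j, ∑ i, π i j = v j

/-- The distance `|a i - b j|` is a sum over the gaps that separate the two points, so the cost of
the monotone coupling is at most the sum of gap length times difference of distribution functions.
The `2k` atoms leave at most `2k - 1` gaps, and each contributes at most `T`. -/
theorem exists_coupling_of_gap_bound {k : ℕ} (hk : 0 < k) {a b w v : Fin k → ℝ} {R T : ℝ}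
    (ha : ∀ i, |a i| ≤ R) (hb : ∀ i, |b i| ≤ R) (hw : ∀ i, 0 ≤ w i) (hv : ∀ i, 0 ≤ v i)
    (hwv : ∑ i, w i = ∑ i, v i) (hT : 0 ≤ T)
    (hgap : ∀ t g : ℝ, 0 < g → g ≤ 2 * R → (∀ i, a i ≤ t ∨ t + g ≤ a i) →
      (∀ i, b i ≤ t ∨ t + g ≤ b i) →
      g * |∑ i, (if a i ≤ t then w i else 0) - ∑ i, (if b i ≤ t then v i else 0)| ≤ T) :
    ∃ π, IsWeightCoupling w v π ∧ ∑ i, ∑ j, π i j * |a i - b j| ≤ 2 * k * T := by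
  obtain ⟨π, hπ⟩ := exists_isMonotoneCoupling a b Finset.univ Finset.univ w v
    (fun i _ => hw i) (fun j _ => hv j) hwv
  refine ⟨π, ⟨hπ.nonneg, fun i => hπ.row i (Finset.mem_univ i),
    fun j => hπ.col j (Finset.mem_univ j)⟩, ?_⟩
  obtain ⟨z, hz, hzf, hfz⟩ := exists_monotone_enumeration (n := k + k) (by omega) (Fin.append a b)
  have hza : ∀ i, ∃ p ≤ k + k - 1, a i = z p := fun i => by
    simpa using hfz (Fin.castAdd k i)
  have hzb : ∀ i, ∃ p ≤ k + k - 1, b i = z p := fun i => by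
    have := hfz (Fin.natAdd k i)
    rwa [Fin.append_right] at this
  have hzR : ∀ r, |z r| ≤ R := fun r => by
    obtain ⟨i, hi⟩ := hzf r
    rw [hi]
    induction i using Fin.addCases with
    | left i => simpa using ha i
    | right i => rw [Fin.append_right]; exact hb i
  have hnn : ∀ r, 0 ≤ z (r + 1) - z r := fun r => sub_nonneg.2 (hz r.le_succ)
  have hsplit : ∀ r p, z p ≤ z r ∨ z r + (z (r + 1) - z r) ≤ z p := fun r p => by
    rcases Nat.lt_or_ge r p with h | h
    · right
      have := hz (Nat.succ_le_of_lt h)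
      simp only [Nat.succ_eq_add_one] at this
      linarith
    · exact Or.inl (hz h)
  calc ∑ i, ∑ j, π i j * |a i - b j|
      ≤ ∑ i, ∑ j, ∑ r ∈ Finset.range (k + k - 1), (z (r + 1) - z r) * (π i j *
        |(if a i ≤ z r then (1 : ℝ) else 0) - (if b j ≤ z r then 1 else 0)|) := by
        refine Finset.sum_le_sum fun i _ => Finset.sum_le_sum fun j _ => ?_
        obtain ⟨p, hp, hap⟩ := hza i
        obtain ⟨q, hq, hbq⟩ := hzb j
        rw [hap, hbq]
        refine (mul_le_mul_of_nonneg_left (hz.abs_sub_le_sum_gaps hp hq) (hπ.nonneg i j)).trans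
          (le_of_eq ?_)
        rw [Finset.mul_sum]
        exact Finset.sum_congr rfl fun r _ => by ring
    _ = ∑ r ∈ Finset.range (k + k - 1), (z (r + 1) - z r) * ∑ i, ∑ j, π i j *
        |(if a i ≤ z r then (1 : ℝ) else 0) - (if b j ≤ z r then 1 else 0)| := by
        simp only [Finset.mul_sum]
        rw [Finset.sum_comm_cycle]
    _ ≤ ∑ r ∈ Finset.range (k + k - 1), T := by
        refine Finset.sum_le_sum fun r _ => ?_
        refine (mul_le_mul_of_nonneg_left (hπ.sep (z r)) (hnn r)).trans ?_
        rcases (hnn r).eq_or_lt with h0 | h0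
        · rw [← h0, zero_mul]; exact hT
        · refine hgap (z r) _ h0 ?_ ?_ ?_
          · have := abs_le.1 (hzR r)
            have := abs_le.1 (hzR (r + 1))
            linarith
          · intro i
            obtain ⟨p, -, hp⟩ := hza i
            rw [hp]; exact hsplit r p
          · intro i
            obtain ⟨p, -, hp⟩ := hzb i
            rw [hp]; exact hsplit r p
    _ = ((k + k - 1 : ℕ) : ℝ) * T := by simp
    _ ≤ 2 * k * T := by
        refine mul_le_mul_of_nonneg_right ?_ hT
        calc ((k + k - 1 : ℕ) : ℝ) ≤ ((k + k : ℕ) : ℝ) := by exact_mod_cast Nat.sub_le _ _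
          _ = 2 * k := by push_cast; ring

/-- The Wasserstein distance on the line of two `k`-atomic distributions with close exponential
moments. -/
theorem exists_coupling_of_exp_moments {k : ℕ} (hk : 0 < k) {a b w v : Fin k → ℝ} {R δ : ℝ}
    (hR : 0 ≤ R) (ha : ∀ i, |a i| ≤ R) (hb : ∀ i, |b i| ≤ R)
    (hw : ∀ i, 0 ≤ w i) (hv : ∀ i, 0 ≤ v i)
    (hw1 : ∑ i, w i = 1) (hv1 : ∑ i, v i = 1) (hδ : 0 ≤ δ)
    (hm : ∀ m : ℕ, m ≤ 2 * k - 1 →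
      |∑ i, w i * Real.exp (m / (2 * k) * a i) - ∑ i, v i * Real.exp (m / (2 * k) * b i)| ≤ δ) :
    ∃ π, IsWeightCoupling w v π ∧ ∑ i, ∑ j, π i j * |a i - b j|
      ≤ 2 * k * (4 * k * Real.exp R * (1 + Real.exp R) * δ ^ (1 / (2 * (k : ℝ) - 1))) := by
  have hk1 : (1 : ℝ) ≤ k := by exact_mod_cast hk
  set N := 2 * k - 1 with hN
  have hN1 : 1 ≤ N := by omega
  have hNr : (N : ℝ) = 2 * k - 1 := by
    rw [hN, Nat.cast_sub (by omega)]; push_cast; ring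
  set K := 1 + Real.exp R with hK
  set L := 4 * k * Real.exp R * K with hL
  have hKpos : 0 < K := by positivity
  have hLpos : 0 < L := by positivity
  -- `T` is the gap length at which the moment bound `δ (L / g) ^ N` equals 1.
  set T := L * δ ^ (1 / (2 * (k : ℝ) - 1)) with hTdef
  have hT0 : 0 ≤ T := by positivity
  have hTN : T ^ N = L ^ N * δ := by
    rw [hTdef, mul_pow, ← hNr, ← Real.rpow_natCast (δ ^ (1 / (N : ℝ))), ← Real.rpow_mul hδ,
      one_div_mul_cancel (by positivity), Real.rpow_one]
  refine exists_coupling_of_gap_bound hk ha hb hw hv (hw1.trans hv1.symm) hT0 ?_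
  intro t g hg hgR hat hbt
  set F := ∑ i, (if a i ≤ t then w i else 0)
  set G := ∑ i, (if b i ≤ t then v i else 0)
  have hcdf : ∀ (u c : Fin k → ℝ), (∀ i, 0 ≤ u i) → ∑ i, u i = 1 →
      0 ≤ ∑ i, (if c i ≤ t then u i else 0) ∧ ∑ i, (if c i ≤ t then u i else 0) ≤ 1 := by
    intro u c hu hu1
    constructor
    · refine Finset.sum_nonneg fun i _ => ?_
      split_ifs
      exacts [hu i, le_rfl]
    · rw [← hu1]
      refine Finset.sum_le_sum fun i _ => ?_
      split_ifs
      exacts [le_rfl, hu i]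
  -- Short gaps are harmless, since distribution functions differ by at most 1. For long gaps the
  -- moment bound reads `(T / g) ^ N ≤ T / g`.
  rcases le_or_gt g T with hgT | hgT
  · have hFG : |F - G| ≤ 1 := by
      have h1 := hcdf w a hw hw1
      have h2 := hcdf v b hv hv1
      rw [abs_le]
      constructor <;> linarith
    calc g * |F - G| ≤ g * 1 := by gcongr
      _ ≤ T := by linarith
  · classical
    let c : Fin k ⊕ Fin k → ℝ := Sum.elim a b
    let s : Fin k ⊕ Fin k → ℝ := Sum.elim w (fun j => -v j)
    -- Exponential moments become power moments of these nodes. They stay in `[exp (-R), exp R]`, so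
    -- `K` does not depend on `k`.
    let y : Fin k ⊕ Fin k → ℝ := fun i => Real.exp (c i / (2 * k))
    have hc : ∀ i, |c i| ≤ R := by
      rintro (i | i)
      exacts [ha i, hb i]
    have hct : ∀ i, c i ≤ t ∨ t + g ≤ c i := by
      rintro (i | i)
      exacts [hat i, hbt i]
    have hdivR : ∀ i, |c i / (2 * k)| ≤ R := fun i => by
      rw [abs_div, abs_of_pos (by positivity : (0 : ℝ) < 2 * k)]
      refine (div_le_self (abs_nonneg _) (by linarith)).trans (hc i)
    -- The gap left after exponentiation, from `1 + x ≤ exp x` and the lower bound `exp (-R)` on the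
    -- nodes.
    set g' := g / (2 * k) * Real.exp (-R) with hg'
    have hmain := abs_sum_left_le_of_moments y (K := K) (g := g') (by positivity)
      (by
        calc g' ≤ R * Real.exp (-R) := by
              refine mul_le_mul_of_nonneg_right ?_ (Real.exp_nonneg _)
              rw [div_le_iff₀ (by positivity)]
              nlinarith
          _ ≤ Real.exp R * Real.exp (-R) := by
              refine mul_le_mul_of_nonneg_right ?_ (Real.exp_nonneg _)
              have := Real.add_one_le_exp R
              linarith
          _ = 1 := by rw [← Real.exp_add]; simp
          _ ≤ 2 * K := by have := Real.exp_nonneg R; linarith)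
      (fun i => by
        rw [abs_of_pos (Real.exp_pos _)]
        have := Real.exp_le_exp.2 ((le_abs_self _).trans (hdivR i))
        linarith) N
      (Finset.univ.filter fun i => c i ≤ t) (Finset.univ.filter fun i => ¬ c i ≤ t) s δ
      (by
        intro i hi j hj
        simp only [Finset.mem_filter, Finset.mem_univ, true_and] at hi hj
        have hj' := (hct j).resolve_left hj
        have h1 : c i / (2 * k) + g / (2 * k) ≤ c j / (2 * k) := by
          rw [← add_div]
          gcongr
          linarith
        have h2 : y i * (g / (2 * k) + 1) ≤ y j := by
          calc y i * (g / (2 * k) + 1) ≤ y i * Real.exp (g / (2 * k)) :=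
                mul_le_mul_of_nonneg_left (Real.add_one_le_exp _) (Real.exp_nonneg _)
            _ = Real.exp (c i / (2 * k) + g / (2 * k)) := by rw [Real.exp_add]
            _ ≤ y j := Real.exp_le_exp.2 h1
        have h3 : Real.exp (-R) ≤ y i := Real.exp_le_exp.2 (abs_le.1 (hdivR i)).1
        have h4 : g / (2 * k) * Real.exp (-R) ≤ g / (2 * k) * y i := by gcongr
        rw [hg']
        linarith)
      (by
        rw [Finset.card_filter_add_card_filter_not]
        simp only [Finset.card_univ, Fintype.card_sum, Fintype.card_fin]
        omega)
      (by
        intro m hmN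
        rw [Finset.sum_filter_add_sum_filter_not, Fintype.sum_sum_type]
        refine le_trans (le_of_eq ?_) (hm m hmN)
        rw [sub_eq_add_neg, ← Finset.sum_neg_distrib]
        congr 2 <;> refine Finset.sum_congr rfl fun i _ => ?_
        · simp only [s, y, c, Sum.elim_inl, ← Real.exp_nat_mul]
          congr 2; ring
        · simp only [s, y, c, Sum.elim_inr, ← Real.exp_nat_mul]
          rw [neg_mul]
          congr 3; ring)
    have hFG : ∑ i ∈ Finset.univ.filter (fun i => c i ≤ t), s i = F - G := by
      rw [Finset.sum_filter, Fintype.sum_sum_type, sub_eq_add_neg, ← Finset.sum_neg_distrib]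
      congr 1
      refine Finset.sum_congr rfl fun i _ => ?_
      change (if b i ≤ t then -v i else 0) = -(if b i ≤ t then v i else 0)
      split_ifs <;> simp
    have hLg : 2 * K / g' = L / g := by
      rw [hg', hL, Real.exp_neg]
      field_simp
      ring
    rw [hFG, hLg, div_pow, ← mul_div_assoc, mul_comm δ, ← hTN, ← div_pow] at hmain
    have hTg : T / g ≤ 1 := (div_le_one hg).2 hgT.le
    calc g * |F - G| ≤ g * (T / g) ^ N := by gcongr
      _ ≤ g * (T / g) := by
          gcongr
          exact pow_le_of_le_one (by positivity) hTg (by omega)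
      _ = T := by field_simp

/-! ### Expectations and the Hellinger distance -/

section Hellinger

variable {α : Type*} [MeasurableSpace α] {P Q : Measure α} [IsFiniteMeasure P] [IsFiniteMeasure Q]

theorem sq_sqrt_sub_sqrt_le {p q : ℝ} (hp : 0 ≤ p) (hq : 0 ≤ q) : (√p - √q) ^ 2 ≤ p + q := by
  nlinarith [Real.sq_sqrt hp, Real.sq_sqrt hq, Real.sqrt_nonneg p, Real.sqrt_nonneg q,
    mul_nonneg (Real.sqrt_nonneg p) (Real.sqrt_nonneg q)]

theorem integrable_sq_sqrt_rnDeriv_sub :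
    Integrable (fun x => (√(P.rnDeriv (P + Q) x).toReal - √(Q.rnDeriv (P + Q) x).toReal) ^ 2)
      (P + Q) := by
  refine (Measure.integrable_toReal_rnDeriv.add Measure.integrable_toReal_rnDeriv :
    Integrable (fun x => (P.rnDeriv (P + Q) x).toReal + (Q.rnDeriv (P + Q) x).toReal) (P + Q)).mono'
    ?_ (ae_of_all _ fun x => ?_)
  · exact (((Measure.measurable_rnDeriv _ _).ennreal_toReal.sqrt.sub
      (Measure.measurable_rnDeriv _ _).ennreal_toReal.sqrt).pow_const 2).aestronglyMeasurable
  · rw [Real.norm_of_nonneg (sq_nonneg _)]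
    exact sq_sqrt_sub_sqrt_le ENNReal.toReal_nonneg ENNReal.toReal_nonneg

theorem hellinger_eq_ofReal : hellinger P Q = ENNReal.ofReal
    (√(∫ x, (√(P.rnDeriv (P + Q) x).toReal - √(Q.rnDeriv (P + Q) x).toReal) ^ 2 ∂(P + Q))) := by
  rw [hellinger, ← ofReal_integral_eq_lintegral_ofReal integrable_sq_sqrt_rnDeriv_sub
    (ae_of_all _ fun x => sq_nonneg _), ENNReal.ofReal_rpow_of_nonneg
    (integral_nonneg fun x => sq_nonneg _) (by norm_num), Real.sqrt_eq_rpow]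

theorem hellinger_ne_top : hellinger P Q ≠ ⊤ := by
  rw [hellinger_eq_ofReal]
  exact ENNReal.ofReal_ne_top

/-- Expectations of a square-integrable function differ by at most a multiple of the Hellinger
distance. -/
theorem abs_integral_sub_le_hellinger {f : α → ℝ} (hf : Measurable f)
    (hfP : Integrable f P) (hfQ : Integrable f Q)
    (hP : Integrable (fun x => f x ^ 2) P) (hQ : Integrable (fun x => f x ^ 2) Q) :
    |∫ x, f x ∂P - ∫ x, f x ∂Q|
      ≤ (hellinger P Q).toReal * √(2 * (∫ x, f x ^ 2 ∂P + ∫ x, f x ^ 2 ∂Q)) := by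
  have hPm : P ≪ P + Q := Measure.absolutelyContinuous_of_le (Measure.le_add_right le_rfl)
  have hQm : Q ≪ P + Q := Measure.absolutelyContinuous_of_le (Measure.le_add_left le_rfl)
  set p : α → ℝ := fun x => (P.rnDeriv (P + Q) x).toReal with hp
  set q : α → ℝ := fun x => (Q.rnDeriv (P + Q) x).toReal with hq
  have hp0 : ∀ x, 0 ≤ p x := fun x => ENNReal.toReal_nonneg
  have hq0 : ∀ x, 0 ≤ q x := fun x => ENNReal.toReal_nonneg
  have hpm : Measurable p := (Measure.measurable_rnDeriv _ _).ennreal_toReal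
  have hqm : Measurable q := (Measure.measurable_rnDeriv _ _).ennreal_toReal
  have iP : ∀ {g : α → ℝ}, Integrable g P → Integrable (fun x => p x * g x) (P + Q) :=
    fun h => (integrable_rnDeriv_smul_iff hPm).2 h
  have iQ : ∀ {g : α → ℝ}, Integrable g Q → Integrable (fun x => q x * g x) (P + Q) :=
    fun h => (integrable_rnDeriv_smul_iff hQm).2 h
  have eP : ∀ g : α → ℝ, ∫ x, p x * g x ∂(P + Q) = ∫ x, g x ∂P :=
    fun g => integral_rnDeriv_smul (f := g) hPm
  have eQ : ∀ g : α → ℝ, ∫ x, q x * g x ∂(P + Q) = ∫ x, g x ∂Q :=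
    fun g => integral_rnDeriv_smul (f := g) hQm
  set G : α → ℝ := fun x => √(p x) - √(q x) with hG
  set K : α → ℝ := fun x => f x * (√(p x) + √(q x)) with hK
  have hGm : Measurable G := hpm.sqrt.sub hqm.sqrt
  have hKm : Measurable K := hf.mul (hpm.sqrt.add hqm.sqrt)
  have hKle : ∀ x, K x ^ 2 ≤ 2 * (p x * f x ^ 2 + q x * f x ^ 2) := fun x => by
    have h1 : (√(p x) + √(q x)) ^ 2 ≤ 2 * (p x + q x) := by
      nlinarith [Real.sq_sqrt (hp0 x), Real.sq_sqrt (hq0 x), sq_nonneg (√(p x) - √(q x))]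
    have h2 := mul_le_mul_of_nonneg_left h1 (sq_nonneg (f x))
    rw [hK, mul_pow]
    linarith
  have hKint : Integrable (fun x => 2 * (p x * f x ^ 2 + q x * f x ^ 2)) (P + Q) :=
    ((iP hP).add (iQ hQ)).const_mul 2
  have hK2 : Integrable (fun x => K x ^ 2) (P + Q) :=
    hKint.mono' (hKm.pow_const 2).aestronglyMeasurable (ae_of_all _ fun x => by
      rw [Real.norm_of_nonneg (sq_nonneg _)]; exact hKle x)
  have hG2 : Integrable (fun x => G x ^ 2) (P + Q) := integrable_sq_sqrt_rnDeriv_sub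
  have hcs := integral_mul_norm_le_Lp_mul_Lq (μ := P + Q) (f := G) (g := K)
    (Real.HolderConjugate.two_two)
    (by simpa using (memLp_two_iff_integrable_sq hGm.aestronglyMeasurable).2 hG2)
    (by simpa using (memLp_two_iff_integrable_sq hKm.aestronglyMeasurable).2 hK2)
  -- The factorization `f (p - q) = (√p - √q) · f (√p + √q)` prepares Cauchy–Schwarz.
  have hdiff : ∫ x, f x ∂P - ∫ x, f x ∂Q = ∫ x, G x * K x ∂(P + Q) := by
    rw [← eP, ← eQ, ← integral_sub (iP hfP) (iQ hfQ)]
    refine integral_congr_ae (ae_of_all _ fun x => ?_)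
    simp only [hG, hK]
    linear_combination (- f x) * Real.sq_sqrt (hp0 x) + f x * Real.sq_sqrt (hq0 x)
  have hHell : (hellinger P Q).toReal = √(∫ x, G x ^ 2 ∂(P + Q)) := by
    rw [hellinger_eq_ofReal, ENNReal.toReal_ofReal (Real.sqrt_nonneg _)]
  rw [hdiff, hHell]
  calc |∫ x, G x * K x ∂(P + Q)| ≤ ∫ x, ‖G x‖ * ‖K x‖ ∂(P + Q) := by
        rw [← Real.norm_eq_abs]
        refine (norm_integral_le_integral_norm _).trans (le_of_eq ?_)
        simp only [norm_mul]
    _ ≤ √(∫ x, G x ^ 2 ∂(P + Q)) * √(∫ x, K x ^ 2 ∂(P + Q)) := by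
        refine hcs.trans (le_of_eq ?_)
        simp only [Real.rpow_two, Real.norm_eq_abs, sq_abs, Real.sqrt_eq_rpow]
    _ ≤ _ := by
        refine mul_le_mul_of_nonneg_left (Real.sqrt_le_sqrt ?_) (Real.sqrt_nonneg _)
        refine (integral_mono hK2 hKint hKle).trans (le_of_eq ?_)
        rw [integral_const_mul, integral_add (iP hP) (iQ hQ), eP, eQ]

end Hellinger

/-! ### Atomic mixing distributions and their Laplace transforms -/

section Atomic

variable {ι : Type*} [Fintype ι] {d : ℕ}

/-- The measure `∑ w_j δ_{μ_j}`. -/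
noncomputable def atomic (w : ι → ℝ) (μ : ι → Euc d) : Measure (Euc d) :=
  ∑ j, ENNReal.ofReal (w j) • Measure.dirac (μ j)

theorem lintegral_atomic (w : ι → ℝ) (μ : ι → Euc d) {f : Euc d → ℝ≥0∞} (hf : Measurable f) :
    ∫⁻ x, f x ∂(atomic w μ) = ∑ j, ENNReal.ofReal (w j) * f (μ j) := by
  simp [atomic, lintegral_smul_measure, lintegral_dirac' _ hf]

theorem isProbabilityMeasure_atomic {w : ι → ℝ} (μ : ι → Euc d) (hw : ∀ j, 0 ≤ w j)
    (hw1 : ∑ j, w j = 1) : IsProbabilityMeasure (atomic w μ) := by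
  constructor
  rw [← lintegral_one, lintegral_atomic w μ measurable_const]
  simp [← ENNReal.ofReal_sum_of_nonneg fun j _ => hw j, hw1]

theorem map_atomic {d' : ℕ} (w : ι → ℝ) (μ : ι → Euc d) {f : Euc d → Euc d'} (hf : Measurable f) :
    (atomic w μ).map f = atomic w (fun j => f (μ j)) := by
  refine Measure.ext_of_lintegral _ fun g hg => ?_
  rw [lintegral_map hg hf, lintegral_atomic w μ (f := fun x => g (f x)) (hg.comp hf),
    lintegral_atomic _ _ hg]

instance isProbabilityMeasure_gaussMix {Γ : Measure (Euc d)} [IsProbabilityMeasure Γ] :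
    IsProbabilityMeasure (gaussMix Γ) := by
  unfold gaussMix
  infer_instance

theorem map_inner_stdGaussian (s : Euc d) :
    (stdGaussian (Euc d)).map (fun x => inner ℝ s x) = gaussianReal 0 (‖s‖₊ ^ 2) := by
  have h := IsGaussian.map_eq_gaussianReal (μ := stdGaussian (Euc d)) (innerSL ℝ s)
  rw [integral_strongDual_stdGaussian, variance_dual_stdGaussian, innerSL_apply_norm] at h
  have e : (‖s‖ ^ 2).toNNReal = ‖s‖₊ ^ 2 := by
    rw [← coe_nnnorm, ← NNReal.coe_pow, Real.toNNReal_coe]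
  rw [e] at h
  exact h

theorem lintegral_exp_inner_stdGaussian (s : Euc d) :
    ∫⁻ x, ENNReal.ofReal (Real.exp (inner ℝ s x)) ∂(stdGaussian (Euc d))
      = ENNReal.ofReal (Real.exp (‖s‖ ^ 2 / 2)) := by
  have h := lintegral_map (μ := stdGaussian (Euc d)) (f := fun t : ℝ => ENNReal.ofReal (Real.exp t))
    (g := fun x => inner ℝ s x) (by fun_prop) (by fun_prop)
  rw [← h, map_inner_stdGaussian, ← ofReal_integral_eq_lintegral_ofReal]
  · have := congrFun (mgf_fun_id_gaussianReal (μ := 0) (v := ‖s‖₊ ^ 2)) 1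
    simp only [mgf, one_mul] at this
    rw [this]
    simp
  · simpa using integrable_exp_mul_gaussianReal (μ := 0) (v := ‖s‖₊ ^ 2) 1
  · exact ae_of_all _ fun x => (Real.exp_pos _).le

/-- The Laplace transform of `∑ w_j δ_{μ_j}`. -/
noncomputable def laplace (w : ι → ℝ) (μ : ι → Euc d) (s : Euc d) : ℝ :=
  ∑ j, w j * Real.exp (inner ℝ s (μ j))

theorem laplace_nonneg {w : ι → ℝ} (hw : ∀ j, 0 ≤ w j) (μ : ι → Euc d) (s : Euc d) :
    0 ≤ laplace w μ s :=
  Finset.sum_nonneg fun j _ => mul_nonneg (hw j) (Real.exp_nonneg _)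

theorem laplace_le {w : ι → ℝ} (hw : ∀ j, 0 ≤ w j) (hw1 : ∑ j, w j = 1) {μ : ι → Euc d} {R : ℝ}
    (hμ : ∀ j, ‖μ j‖ ≤ R) (s : Euc d) : laplace w μ s ≤ Real.exp (‖s‖ * R) := by
  calc laplace w μ s ≤ ∑ j, w j * Real.exp (‖s‖ * R) := by
        refine Finset.sum_le_sum fun j _ => mul_le_mul_of_nonneg_left ?_ (hw j)
        refine Real.exp_le_exp.2 ((real_inner_le_norm _ _).trans ?_)
        exact mul_le_mul_of_nonneg_left (hμ j) (norm_nonneg _)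
    _ = _ := by rw [← Finset.sum_mul, hw1, one_mul]

theorem lintegral_exp_inner_gaussMix {w : ι → ℝ} (hw : ∀ j, 0 ≤ w j) (μ : ι → Euc d) (s : Euc d) :
    ∫⁻ x, ENNReal.ofReal (Real.exp (inner ℝ s x)) ∂(gaussMix (atomic w μ))
      = ENNReal.ofReal (Real.exp (‖s‖ ^ 2 / 2) * laplace w μ s) := by
  rw [gaussMix, Measure.lintegral_conv (by fun_prop)]
  simp only [inner_add_right, Real.exp_add, ENNReal.ofReal_mul (Real.exp_nonneg _)]
  simp_rw [lintegral_const_mul _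
    (show Measurable fun y : Euc d => ENNReal.ofReal (Real.exp (inner ℝ s y)) by fun_prop),
    lintegral_exp_inner_stdGaussian]
  rw [lintegral_atomic _ _ (by fun_prop), laplace,
    ENNReal.ofReal_sum_of_nonneg fun j _ => mul_nonneg (hw j) (Real.exp_nonneg _), Finset.mul_sum]
  refine Finset.sum_congr rfl fun j _ => ?_
  rw [ENNReal.ofReal_mul (hw j)]
  ring

theorem integrable_exp_inner_gaussMix {w : ι → ℝ} (hw : ∀ j, 0 ≤ w j) (μ : ι → Euc d)
    (s : Euc d) : Integrable (fun x => Real.exp (inner ℝ s x)) (gaussMix (atomic w μ)) := by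
  refine ⟨(by fun_prop : Measurable _).aestronglyMeasurable, ?_⟩
  rw [hasFiniteIntegral_iff_ofReal (ae_of_all _ fun x => (Real.exp_pos _).le),
    lintegral_exp_inner_gaussMix hw]
  exact ENNReal.ofReal_lt_top

theorem integral_exp_inner_gaussMix {w : ι → ℝ} (hw : ∀ j, 0 ≤ w j) (μ : ι → Euc d)
    (s : Euc d) : ∫ x, Real.exp (inner ℝ s x) ∂(gaussMix (atomic w μ))
      = Real.exp (‖s‖ ^ 2 / 2) * laplace w μ s := by
  rw [integral_eq_lintegral_of_nonneg_ae (ae_of_all _ fun x => (Real.exp_pos _).le)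
    (by fun_prop : Measurable _).aestronglyMeasurable, lintegral_exp_inner_gaussMix hw,
    ENNReal.toReal_ofReal (mul_nonneg (Real.exp_nonneg _) (laplace_nonneg hw _ _))]

/-- The test function `exp ⟨s, x⟩` has mean `exp (‖s‖² / 2)` times the transform at `s`, and its
square has a mean governed by the transform at `2s`. The Gaussian factors partly cancel, and the
remaining constant involves neither `d` nor the number of atoms. -/
theorem abs_laplace_sub_le_hellinger {w : ι → ℝ} {μ : ι → Euc d}
    {v : ι → ℝ} {ν : ι → Euc d} {R : ℝ} (hR : 0 ≤ R)
    (hw : ∀ j, 0 ≤ w j) (hw1 : ∑ j, w j = 1) (hμ : ∀ j, ‖μ j‖ ≤ R)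
    (hv : ∀ j, 0 ≤ v j) (hv1 : ∑ j, v j = 1) (hν : ∀ j, ‖ν j‖ ≤ R) {s : Euc d} (hs : ‖s‖ ≤ 1) :
    |laplace w μ s - laplace v ν s| ≤ 2 * Real.exp (R + 1 / 2)
      * (hellinger (gaussMix (atomic w μ)) (gaussMix (atomic v ν))).toReal := by
  have := isProbabilityMeasure_atomic μ hw hw1
  have := isProbabilityMeasure_atomic ν hv hv1
  have hsq : ∀ x : Euc d, Real.exp (inner ℝ s x) ^ 2 = Real.exp (inner ℝ ((2 : ℝ) • s) x) :=
    fun x => by rw [← Real.exp_nat_mul, real_inner_smul_left]; norm_num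
  have h := abs_integral_sub_le_hellinger (P := gaussMix (atomic w μ)) (Q := gaussMix (atomic v ν))
    (f := fun x => Real.exp (inner ℝ s x)) (by fun_prop)
    (integrable_exp_inner_gaussMix hw μ s) (integrable_exp_inner_gaussMix hv ν s)
    (by simpa only [hsq] using integrable_exp_inner_gaussMix hw μ ((2 : ℝ) • s))
    (by simpa only [hsq] using integrable_exp_inner_gaussMix hv ν ((2 : ℝ) • s))
  simp only [hsq, integral_exp_inner_gaussMix hw, integral_exp_inner_gaussMix hv] at h
  rw [← mul_sub, abs_mul, abs_of_pos (Real.exp_pos _), ← mul_add] at h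
  have hn : ‖(2 : ℝ) • s‖ = 2 * ‖s‖ := by rw [norm_smul]; norm_num
  have hl : ∀ {u : ι → ℝ} {ξ : ι → Euc d}, (∀ j, 0 ≤ u j) →
      ∑ j, u j = 1 → (∀ j, ‖ξ j‖ ≤ R) →
      laplace u ξ ((2 : ℝ) • s) ≤ Real.exp (2 * R) := by
    intro u ξ hu hu1 hξ
    refine (laplace_le hu hu1 hξ _).trans (Real.exp_le_exp.2 ?_)
    rw [hn]
    nlinarith [norm_nonneg s]
  have h2 : √(2 * (Real.exp (‖(2 : ℝ) • s‖ ^ 2 / 2)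
        * (laplace w μ ((2 : ℝ) • s) + laplace v ν ((2 : ℝ) • s))))
      ≤ 2 * Real.exp (R + ‖s‖ ^ 2) := by
    rw [Real.sqrt_le_left (by positivity), hn]
    calc 2 * (Real.exp ((2 * ‖s‖) ^ 2 / 2)
          * (laplace w μ ((2 : ℝ) • s) + laplace v ν ((2 : ℝ) • s)))
        ≤ 2 * (Real.exp ((2 * ‖s‖) ^ 2 / 2) * (Real.exp (2 * R) + Real.exp (2 * R))) := by
          gcongr
          · exact hl hw hw1 hμ
          · exact hl hv hv1 hν
      _ = (2 * Real.exp (R + ‖s‖ ^ 2)) ^ 2 := by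
          rw [mul_pow 2 (Real.exp _), ← Real.exp_nat_mul, ← two_mul]
          have : Real.exp ((2 : ℕ) * (R + ‖s‖ ^ 2))
              = Real.exp ((2 * ‖s‖) ^ 2 / 2) * Real.exp (2 * R) := by
            rw [← Real.exp_add]; congr 1; push_cast; ring
          rw [this]; ring
  set H := (hellinger (gaussMix (atomic w μ)) (gaussMix (atomic v ν))).toReal
  have hH : 0 ≤ H := ENNReal.toReal_nonneg
  have h3 : Real.exp (‖s‖ ^ 2 / 2) * |laplace w μ s - laplace v ν s|
      ≤ Real.exp (‖s‖ ^ 2 / 2) * (2 * Real.exp (R + ‖s‖ ^ 2 / 2) * H) := by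
    refine h.trans ((mul_le_mul_of_nonneg_left h2 hH).trans (le_of_eq ?_))
    have : Real.exp (R + ‖s‖ ^ 2) = Real.exp (‖s‖ ^ 2 / 2) * Real.exp (R + ‖s‖ ^ 2 / 2) := by
      rw [← Real.exp_add]; congr 1; ring
    rw [this]; ring
  refine (le_of_mul_le_mul_left h3 (Real.exp_pos _)).trans ?_
  gcongr
  nlinarith [norm_nonneg s]

end Atomic

/-! ### A good projection direction -/

/-- The density is at most `1 / √(2πv)`, the interval has length `2c`, and `√(2π) ≥ 2`. -/
theorem gaussianReal_abs_le_le {v : NNReal} (hv : v ≠ 0) {c : ℝ} (hc : 0 ≤ c) :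
    gaussianReal 0 v {t | |t| ≤ c} ≤ ENNReal.ofReal (c / √v) := by
  have hset : {t : ℝ | |t| ≤ c} = Set.Icc (-c) c := by ext t; simp [abs_le]
  have hv' : (0 : ℝ) < v := by positivity
  rw [hset, gaussianReal_apply _ hv]
  calc ∫⁻ x in Set.Icc (-c) c, gaussianPDF 0 v x
      ≤ ∫⁻ x in Set.Icc (-c) c, ENNReal.ofReal (√(2 * Real.pi * v))⁻¹ := by
        refine lintegral_mono fun x => ENNReal.ofReal_le_ofReal ?_
        rw [gaussianPDFReal]
        refine mul_le_of_le_one_right (by positivity) (Real.exp_le_one_iff.2 ?_)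
        rw [neg_div, neg_nonpos]
        positivity
    _ = ENNReal.ofReal ((√(2 * Real.pi * v))⁻¹ * (2 * c)) := by
        rw [setLIntegral_const, Real.volume_Icc, ← ENNReal.ofReal_mul (by positivity)]
        congr 2; ring
    _ ≤ ENNReal.ofReal (c / √v) := by
        refine ENNReal.ofReal_le_ofReal ?_
        rw [Real.sqrt_mul (by positivity)]
        have h2 : 2 ≤ √(2 * Real.pi) := by
          rw [Real.le_sqrt (by norm_num) (by positivity)]
          nlinarith [Real.pi_gt_three]
        rw [mul_inv, div_eq_mul_inv]
        have : (√(2 * Real.pi))⁻¹ * 2 ≤ 1 := by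
          rw [inv_mul_le_iff₀ (by positivity)]; linarith
        calc (√(2 * Real.pi))⁻¹ * (√(v : ℝ))⁻¹ * (2 * c)
            = ((√(2 * Real.pi))⁻¹ * 2) * (c * (√(v : ℝ))⁻¹) := by ring
          _ ≤ 1 * (c * (√(v : ℝ))⁻¹) := by gcongr
          _ = _ := one_mul _

theorem stdGaussian_abs_inner_le {d : ℕ} {s : Euc d} (hs : s ≠ 0) {t : ℝ} (ht : 0 ≤ t) :
    stdGaussian (Euc d) {x | |inner ℝ s x| ≤ t * ‖s‖} ≤ ENNReal.ofReal t := by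
  have h := gaussianReal_abs_le_le (v := ‖s‖₊ ^ 2) (by simpa using hs)
    (mul_nonneg ht (norm_nonneg s))
  rw [← map_inner_stdGaussian, Measure.map_apply (by fun_prop)
    (measurableSet_le (by fun_prop) (by fun_prop))] at h
  have hs' : ‖s‖ ≠ 0 := by simpa using hs
  simpa [Real.sqrt_sq (norm_nonneg s), mul_div_cancel_right₀ _ hs'] using h

theorem lintegral_sq_inner_stdGaussian {d : ℕ} {s : Euc d} (hs : ‖s‖ = 1) :
    ∫⁻ x, ENNReal.ofReal (inner ℝ s x ^ 2) ∂(stdGaussian (Euc d)) = 1 := by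
  have h := lintegral_map (μ := stdGaussian (Euc d)) (f := fun t : ℝ => ENNReal.ofReal (t ^ 2))
    (g := fun x => inner ℝ s x) (by fun_prop) (by fun_prop)
  have hs' : ‖s‖₊ = 1 := by ext; simpa using hs
  rw [← h, map_inner_stdGaussian, hs', one_pow, ← ofReal_integral_eq_lintegral_ofReal]
  · have h1 := variance_id_gaussianReal (μ := 0) (v := 1)
    rw [variance_eq_integral (by fun_prop)] at h1
    simp only [id, integral_id_gaussianReal, sub_zero, NNReal.coe_one] at h1
    rw [h1, ENNReal.ofReal_one]
  · exact (memLp_two_iff_integrable_sq (by fun_prop)).1 (memLp_id_gaussianReal 2)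
  · exact ae_of_all _ fun x => sq_nonneg _

theorem lintegral_sq_norm_stdGaussian (d : ℕ) :
    ∫⁻ x, ENNReal.ofReal (‖x‖ ^ 2) ∂(stdGaussian (Euc d)) = d := by
  have h : ∀ x : Euc d, ENNReal.ofReal (‖x‖ ^ 2)
      = ∑ i, ENNReal.ofReal (inner ℝ (EuclideanSpace.basisFun (Fin d) ℝ i) x ^ 2) := fun x => by
    rw [← ENNReal.ofReal_sum_of_nonneg fun i _ => sq_nonneg _,
      (EuclideanSpace.basisFun (Fin d) ℝ).sum_sq_inner_right]
  simp_rw [h]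
  rw [lintegral_finsetSum _ fun i _ => by fun_prop]
  simp [lintegral_sq_inner_stdGaussian]

/-- Finitely many vectors have a common direction along which none of them shrinks much. -/
theorem exists_direction {ι : Type*} [Fintype ι] {d : ℕ} (hd : 0 < d) {M : ℝ} (hM : 0 < M)
    (hι : (Fintype.card ι : ℝ) ≤ M) (v : ι → Euc d) :
    ∃ u : Euc d, ‖u‖ ≤ 1 ∧ ∀ p, ‖v p‖ ≤ 4 * M * √d * |inner ℝ u (v p)| := by
  classical
  have hd' : (0 : ℝ) < d := by exact_mod_cast hd
  -- For a Gaussian vector the first event has probability at most `1/2` by anti-concentration and a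
  -- union bound, the second at most `1/4` by Markov. A vector outside both, divided by `2√d`,
  -- serves as `u`.
  let bad : Set (Euc d) := (⋃ p ∈ Finset.univ.filter (fun p => v p ≠ 0),
    {x | |inner ℝ (v p) x| ≤ 1 / (2 * M) * ‖v p‖}) ∪ {x | ENNReal.ofReal (4 * d) ≤
      ENNReal.ofReal (‖x‖ ^ 2)}
  have h1 : stdGaussian (Euc d) (⋃ p ∈ Finset.univ.filter (fun p => v p ≠ 0),
      {x | |inner ℝ (v p) x| ≤ 1 / (2 * M) * ‖v p‖}) ≤ ENNReal.ofReal (1 / 2) := by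
    refine (measure_biUnion_finset_le _ _).trans ?_
    calc _ ≤ ∑ p ∈ Finset.univ.filter (fun p => v p ≠ 0), ENNReal.ofReal (1 / (2 * M)) :=
          Finset.sum_le_sum fun p hp =>
            stdGaussian_abs_inner_le (Finset.mem_filter.1 hp).2 (by positivity)
      _ ≤ ∑ p : ι, ENNReal.ofReal (1 / (2 * M)) :=
          Finset.sum_le_sum_of_subset (Finset.filter_subset _ _)
      _ = ENNReal.ofReal (Fintype.card ι * (1 / (2 * M))) := by
          rw [Finset.sum_const, nsmul_eq_mul, ENNReal.ofReal_mul (by positivity),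
            ENNReal.ofReal_natCast, Finset.card_univ]
      _ ≤ _ := by
          refine ENNReal.ofReal_le_ofReal ?_
          rw [mul_one_div, div_le_iff₀ (by positivity)]
          linarith
  have h2 : stdGaussian (Euc d) {x | ENNReal.ofReal (4 * d) ≤ ENNReal.ofReal (‖x‖ ^ 2)}
      ≤ ENNReal.ofReal (1 / 4) := by
    have := mul_meas_ge_le_lintegral (μ := stdGaussian (Euc d))
      (f := fun x => ENNReal.ofReal (‖x‖ ^ 2)) (by fun_prop) (ENNReal.ofReal (4 * d))
    rw [lintegral_sq_norm_stdGaussian, mul_comm,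
      ← ENNReal.le_div_iff_mul_le (Or.inl (by simpa using hd.ne')) (Or.inl ENNReal.ofReal_ne_top)]
      at this
    refine this.trans (le_of_eq ?_)
    rw [← ENNReal.ofReal_natCast, ← ENNReal.ofReal_div_of_pos (by positivity)]
    congr 1
    field_simp
  have hbad : stdGaussian (Euc d) bad < 1 := by
    refine ((measure_union_le _ _).trans (add_le_add h1 h2)).trans_lt ?_
    rw [← ENNReal.ofReal_add (by norm_num) (by norm_num), ENNReal.ofReal_lt_one]
    norm_num
  obtain ⟨x, hx⟩ : ∃ x, x ∉ bad := by
    by_contra! h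
    rw [Set.eq_univ_of_forall h, measure_univ] at hbad
    exact lt_irrefl _ hbad
  simp only [bad, Set.mem_union, Set.mem_iUnion, Finset.mem_filter, Finset.mem_univ, true_and,
    Set.mem_ofPred_eq, not_or, not_exists, not_le] at hx
  obtain ⟨hx1, hx2⟩ := hx
  have hx3 : ‖x‖ < 2 * √d := by
    have := (ENNReal.ofReal_lt_ofReal_iff (by positivity)).1 hx2
    refine lt_of_pow_lt_pow_left₀ 2 (by positivity) ?_
    rw [mul_pow, Real.sq_sqrt hd'.le]
    linarith
  refine ⟨(2 * √d)⁻¹ • x, ?_, fun p => ?_⟩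
  · rw [norm_smul, norm_inv, Real.norm_of_nonneg (by positivity), inv_mul_le_iff₀ (by positivity)]
    linarith
  · rw [real_inner_smul_left, abs_mul, abs_of_pos (by positivity), real_inner_comm]
    have : 4 * M * √d * ((2 * √d)⁻¹ * |inner ℝ (v p) x|) = 2 * M * |inner ℝ (v p) x| := by
      field_simp; ring
    rw [this]
    by_cases hp : v p = 0
    · simp [hp]
    · have := hx1 p hp
      rw [one_div, inv_mul_lt_iff₀ (by positivity)] at this
      exact this.le

/-- Two `k`-atomic mixing distributions whose Gaussian mixtures are Hellinger-close are close in
transport cost. -/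
theorem exists_coupling_le_hellinger {k d : ℕ} (hk : 0 < k) (hd : 0 < d) {R : ℝ} (hR : 0 ≤ R)
    {w v : Fin k → ℝ} {μ ν : Fin k → Euc d}
    (hw : ∀ j, 0 ≤ w j) (hw1 : ∑ j, w j = 1) (hμ : ∀ j, ‖μ j‖ ≤ R)
    (hv : ∀ j, 0 ≤ v j) (hv1 : ∑ j, v j = 1) (hν : ∀ j, ‖ν j‖ ≤ R) :
    ∃ π, IsWeightCoupling w v π ∧ ∑ i, ∑ j, π i j * ‖μ i - ν j‖
      ≤ 32 * k ^ 4 * √d * (Real.exp R * (1 + Real.exp R)) * (2 * Real.exp (R + 1 / 2)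
      * (hellinger (gaussMix (atomic w μ)) (gaussMix (atomic v ν))).toReal)
        ^ (1 / (2 * (k : ℝ) - 1)) := by
  have hk' : (0 : ℝ) < k := by exact_mod_cast hk
  -- All `k²` differences `μ i - ν j` must survive, so that any coupling of the projections lifts at
  -- the same loss `4k²√d`.
  obtain ⟨u, hu, hdir⟩ := exists_direction (ι := Fin k × Fin k) hd (M := (k : ℝ) ^ 2) (by positivity)
    (by simp [sq]) (fun p => μ p.1 - ν p.2)
  have hproj : ∀ x : Euc d, ‖x‖ ≤ R → |inner ℝ u x| ≤ R := fun x hx =>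
    (abs_real_inner_le_norm u x).trans
      ((mul_le_of_le_one_left (norm_nonneg x) hu).trans hx)
  set H := (hellinger (gaussMix (atomic w μ)) (gaussMix (atomic v ν))).toReal
  have hH : 0 ≤ H := ENNReal.toReal_nonneg
  obtain ⟨π, hπ, hcost⟩ := exists_coupling_of_exp_moments hk (a := fun i => inner ℝ u (μ i))
    (b := fun i => inner ℝ u (ν i)) (δ := 2 * Real.exp (R + 1 / 2) * H)
    hR (fun i => hproj _ (hμ i)) (fun i => hproj _ (hν i)) hw hv hw1 hv1 (by positivity) (by
      intro m hm
      have hmk : (m : ℝ) / (2 * k) ≤ 1 := by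
        rw [div_le_one (by positivity)]
        have : m ≤ 2 * k := by omega
        exact_mod_cast this
      -- The scaling by `1 / (2k)` keeps all the frequencies in the unit ball, where the Laplace
      -- bound is uniform.
      have hs : ‖((m : ℝ) / (2 * k)) • u‖ ≤ 1 := by
        rw [norm_smul, Real.norm_of_nonneg (by positivity)]
        exact mul_le_one₀ hmk (norm_nonneg _) hu
      have := abs_laplace_sub_le_hellinger hR hw hw1 hμ hv hv1 hν hs
      simpa only [laplace, real_inner_smul_left] using this)
  refine ⟨π, hπ, ?_⟩
  calc ∑ i, ∑ j, π i j * ‖μ i - ν j‖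
      ≤ ∑ i, ∑ j, 4 * (k : ℝ) ^ 2 * √d * (π i j * |inner ℝ u (μ i) - inner ℝ u (ν j)|) := by
        refine Finset.sum_le_sum fun i _ => Finset.sum_le_sum fun j _ => ?_
        have := mul_le_mul_of_nonneg_left (hdir (i, j)) (hπ.nonneg i j)
        rw [inner_sub_right] at this
        linarith
    _ = 4 * (k : ℝ) ^ 2 * √d * ∑ i, ∑ j, π i j * |inner ℝ u (μ i) - inner ℝ u (ν j)| := by
        simp only [Finset.mul_sum]
    _ ≤ _ := mul_le_mul_of_nonneg_left hcost (by positivity)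
    _ = _ := by ring

/-! ### Measurability, Jensen's inequality and sample splitting -/

/-- The Hellinger distance of two measurable families of probability measures is measurable. -/
theorem measurable_hellinger {Ω α : Type*} [MeasurableSpace Ω] [MeasurableSpace α]
    [MeasurableSpace.CountablyGenerated α] {κ η : Ω → Measure α} (hκ : Measurable κ)
    (hη : Measurable η) [∀ x, IsProbabilityMeasure (κ x)] [∀ x, IsProbabilityMeasure (η x)] :
    Measurable fun x => hellinger (κ x) (η x) := by
  let K : Kernel Ω α := ⟨κ, hκ⟩
  let E : Kernel Ω α := ⟨η, hη⟩
  have : IsMarkovKernel K := ⟨fun x => (inferInstance : IsProbabilityMeasure (κ x))⟩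
  have : IsMarkovKernel E := ⟨fun x => (inferInstance : IsProbabilityMeasure (η x))⟩
  -- Densities chosen separately for each `x` need not be jointly measurable; the kernel derivative
  -- is a jointly measurable version that agrees almost everywhere.
  have h : (fun x => hellinger (κ x) (η x)) = fun x => (∫⁻ y, ENNReal.ofReal
      ((√(K.rnDeriv (K + E) x y).toReal - √(E.rnDeriv (K + E) x y).toReal) ^ 2) ∂((K + E) x))
        ^ (1 / 2 : ℝ) := by
    funext x
    rw [hellinger]
    congr 1
    refine lintegral_congr_ae ?_
    have h1 := Kernel.rnDeriv_eq_rnDeriv_measure (κ := K) (η := K + E) (a := x)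
    have h2 := Kernel.rnDeriv_eq_rnDeriv_measure (κ := E) (η := K + E) (a := x)
    filter_upwards [h1, h2] with y hy1 hy2
    rw [hy1, hy2]
    rfl
  rw [h]
  refine (Measurable.lintegral_kernel_prod_right ?_).pow_const _
  exact (((Kernel.measurable_rnDeriv K (K + E)).ennreal_toReal.sqrt.sub
    (Kernel.measurable_rnDeriv E (K + E)).ennreal_toReal.sqrt).pow_const 2).ennreal_ofReal

theorem measurable_map_kernel {Ω α β : Type*} [MeasurableSpace Ω] [MeasurableSpace α]
    [MeasurableSpace β] {κ : Ω → Measure α} (hκ : Measurable κ)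
    [∀ x, IsProbabilityMeasure (κ x)] {f : Ω → α → β} (hf : Measurable (Function.uncurry f)) :
    Measurable fun x => (κ x).map (f x) := by
  let K : Kernel Ω α := ⟨κ, hκ⟩
  have : IsMarkovKernel K := ⟨fun x => (inferInstance : IsProbabilityMeasure (κ x))⟩
  refine Measure.measurable_of_measurable_coe _ fun s hs => ?_
  have h : (fun x => (κ x).map (f x) s) = fun x => K x (Prod.mk x ⁻¹' (Function.uncurry f ⁻¹' s)) := by
    funext x
    have hfx : Measurable (f x) := hf.comp measurable_prodMk_left
    rw [Measure.map_apply hfx hs]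
    rfl
  rw [h]
  exact Kernel.measurable_kernel_prodMk_left (hf hs)

theorem measurable_gaussMix {Ω : Type*} [MeasurableSpace Ω] {d : ℕ} {κ : Ω → Measure (Euc d)}
    (hκ : Measurable κ) [∀ x, IsProbabilityMeasure (κ x)] :
    Measurable fun x => gaussMix (κ x) := by
  refine Measure.measurable_of_measurable_coe _ fun s hs => ?_
  let K : Kernel Ω (Euc d) := ⟨κ, hκ⟩
  have : IsMarkovKernel K := ⟨fun x => (inferInstance : IsProbabilityMeasure (κ x))⟩
  have h : (fun x => gaussMix (κ x) s)
      = fun x => ∫⁻ y, (stdGaussian (Euc d)) {z | y + z ∈ s} ∂(K x) := by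
    funext x
    rw [gaussMix, ← lintegral_indicator_one hs,
      Measure.lintegral_conv (measurable_one.indicator hs)]
    refine lintegral_congr fun y => ?_
    have hs' : MeasurableSet {z | y + z ∈ s} := measurable_const_add y hs
    rw [← lintegral_indicator_one hs']
    rfl
  rw [h]
  refine Measurable.lintegral_kernel ?_
  exact measurable_measure_prodMk_left (measurable_add hs)

theorem lintegral_rpow_le_rpow_lintegral {Ω : Type*} [MeasurableSpace Ω] {μ : Measure Ω}
    [IsProbabilityMeasure μ] {f : Ω → ℝ≥0∞} (hf : Measurable f) {p : ℝ} (hp : 0 < p)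
    (hp1 : p ≤ 1) : ∫⁻ x, f x ^ p ∂μ ≤ (∫⁻ x, f x ∂μ) ^ p := by
  have h := eLpNorm'_le_eLpNorm'_of_exponent_le (f := f) hp hp1 μ hf.aestronglyMeasurable
  simp only [eLpNorm', enorm_eq_self, ENNReal.rpow_one, div_one] at h
  rwa [one_div, ENNReal.rpow_inv_le_iff hp] at h

theorem map_comp_pi {ι κ α : Type*} [Fintype ι] [Fintype κ] [MeasurableSpace α] (P : Measure α)
    [IsProbabilityMeasure P] {e : κ → ι} (he : Function.Injective e) :
    (Measure.pi fun _ : ι => P).map (fun x j => x (e j)) = Measure.pi fun _ : κ => P := by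
  classical
  symm
  refine Measure.pi_eq fun s hs => ?_
  rw [Measure.map_apply (by fun_prop) (.univ_pi hs)]
  have h : (fun (x : ι → α) j => x (e j)) ⁻¹' Set.univ.pi s
      = Set.univ.pi fun i => ⋂ j, ⋂ (_ : e j = i), s j := by
    ext x
    simp only [Set.mem_preimage, Set.mem_pi, Set.mem_univ, true_imp_iff, Set.mem_iInter]
    constructor
    · rintro h i j rfl
      exact h j
    · exact fun h j => h (e j) j rfl
  rw [h, Measure.pi_pi]
  have h1 : ∀ i ∉ Set.range e, P (⋂ j, ⋂ (_ : e j = i), s j) = 1 := by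
    intro i hi
    have : (⋂ j, ⋂ (_ : e j = i), s j) = Set.univ := by
      simp only [Set.iInter_eq_univ]
      exact fun j hj => absurd ⟨j, hj⟩ hi
    rw [this, measure_univ]
  have h2 : ∀ j, (⋂ j', ⋂ (_ : e j' = e j), s j') = s j := by
    intro j
    ext x
    simp only [Set.mem_iInter]
    exact ⟨fun h => h j rfl, fun h j' hj' => he hj' ▸ h⟩
  rw [← Finset.prod_subset (Finset.subset_univ (Finset.univ.image e)) (by
    intro i _ hi
    exact h1 i (by simpa using hi)), Finset.prod_image fun a _ b _ h => he h]
  simp only [h2]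

theorem map_halves_sampleLaw {d m N : ℕ} (h : 2 * m ≤ N) (Γ : Measure (Euc d))
    [IsProbabilityMeasure Γ] :
    (sampleLaw N Γ).map (fun X => (firstHalf h X, secondHalf h X))
      = (sampleLaw m Γ).prod (sampleLaw m Γ) := by
  let e : Fin m ⊕ Fin m → Fin N :=
    Sum.elim (fun i => ⟨i, by omega⟩) (fun i => ⟨m + i, by omega⟩)
  have he : Function.Injective e := by
    rintro (i | i) (j | j) hij
    all_goals
      simp only [e, Sum.elim_inl, Sum.elim_inr, Fin.mk.injEq] at hij
      try (exfalso; omega)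
    · exact congrArg _ (Fin.ext hij)
    · exact congrArg _ (Fin.ext (by omega))
  have h1 := map_comp_pi (gaussMix Γ) he
  have h2 := (measurePreserving_sumPiEquivProdPi
    (fun _ : Fin m ⊕ Fin m => gaussMix Γ)).map_eq
  rw [← h1, Measure.map_map (by fun_prop) (by fun_prop)] at h2
  exact h2

/-! ### Orthonormal frames and projected mixtures -/

section Frame

variable {d r : ℕ}

/-- The linear map `y ↦ Vᵀ y`. -/
noncomputable def projFrameCLM (V : Fin r → Euc d) : Euc d →L[ℝ] Euc r :=
  (EuclideanSpace.equiv (Fin r) ℝ).symm.toContinuousLinearMap ∘L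
    ContinuousLinearMap.pi fun j => innerSL ℝ (V j)

theorem projFrameCLM_apply (V : Fin r → Euc d) (y : Euc d) :
    projFrameCLM V y = projFrame V y := rfl

theorem measurable_projFrame : Measurable fun p : (Fin r → Euc d) × Euc d => projFrame p.1 p.2 := by
  unfold projFrame
  fun_prop

theorem measurable_liftFrame : Measurable fun p : (Fin r → Euc d) × Euc r => liftFrame p.1 p.2 := by
  unfold liftFrame
  fun_prop

theorem inner_projFrame (V : Fin r → Euc d) (y : Euc d) (z : Euc r) :
    inner ℝ z (projFrame V y) = inner ℝ (liftFrame V z) y := by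
  rw [liftFrame, sum_inner, PiLp.inner_apply]
  refine Finset.sum_congr rfl fun j _ => ?_
  rw [real_inner_smul_left, projFrame, real_inner_eq_re_inner, RCLike.inner_apply, mul_comm]
  simp

theorem norm_liftFrame {V : Fin r → Euc d} (hV : Orthonormal ℝ V) (z : Euc r) :
    ‖liftFrame V z‖ = ‖z‖ := by
  rw [← sq_eq_sq₀ (norm_nonneg _) (norm_nonneg _), ← real_inner_self_eq_norm_sq, liftFrame,
    hV.inner_sum, EuclideanSpace.real_norm_sq_eq]
  simp [sq]

theorem liftFrame_sub (V : Fin r → Euc d) (z z' : Euc r) :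
    liftFrame V (z - z') = liftFrame V z - liftFrame V z' := by
  simp [liftFrame, sub_smul]

theorem liftFrame_mem_span (V : Fin r → Euc d) (z : Euc r) :
    liftFrame V z ∈ Submodule.span ℝ (Set.range V) :=
  Submodule.sum_mem _ fun j _ => Submodule.smul_mem _ _ (Submodule.subset_span ⟨j, rfl⟩)

/-- The component of `y` orthogonal to the frame. -/
noncomputable def frameResidual (V : Fin r → Euc d) (y : Euc d) : Euc d :=
  y - liftFrame V (projFrame V y)

theorem measurable_frameResidual : Measurable fun p : (Fin r → Euc d) × Euc d => frameResidual p.1 p.2 := by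
  unfold frameResidual liftFrame projFrame
  fun_prop

theorem inner_frameResidual {V : Fin r → Euc d} (hV : Orthonormal ℝ V) (y : Euc d) {x : Euc d}
    (hx : x ∈ Submodule.span ℝ (Set.range V)) : inner ℝ (frameResidual V y) x = 0 := by
  induction hx using Submodule.span_induction with
  | mem x hx =>
    obtain ⟨j, rfl⟩ := hx
    rw [frameResidual, inner_sub_left, liftFrame, hV.inner_left_fintype, projFrame]
    simp [real_inner_comm]
  | zero => simp
  | add x y _ _ hx hy => rw [inner_add_right, hx, hy, add_zero]
  | smul c x _ hx => rw [real_inner_smul_right, hx, mul_zero]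

theorem inner_frameResidual_self {V : Fin r → Euc d} (hV : Orthonormal ℝ V) (y : Euc d) :
    inner ℝ (frameResidual V y) y = ‖frameResidual V y‖ ^ 2 := by
  have h : y = frameResidual V y + liftFrame V (projFrame V y) := (sub_add_cancel y _).symm
  calc inner ℝ (frameResidual V y) y
      = inner ℝ (frameResidual V y) (frameResidual V y + liftFrame V (projFrame V y)) := by rw [← h]
    _ = ‖frameResidual V y‖ ^ 2 := by
      rw [inner_add_right, inner_frameResidual hV y (liftFrame_mem_span V _), add_zero,
        real_inner_self_eq_norm_sq]

theorem frameResidual_eq_zero_iff {V : Fin r → Euc d} (hV : Orthonormal ℝ V) {y : Euc d} :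
    frameResidual V y = 0 ↔ y ∈ Submodule.span ℝ (Set.range V) := by
  constructor
  · intro h
    rw [frameResidual, sub_eq_zero] at h
    rw [h]
    exact liftFrame_mem_span V _
  · intro h
    rw [← norm_eq_zero, ← sq_eq_zero_iff, ← inner_frameResidual_self hV, inner_frameResidual hV y h]

theorem norm_projFrame_le {V : Fin r → Euc d} (hV : Orthonormal ℝ V) (y : Euc d) :
    ‖projFrame V y‖ ≤ ‖y‖ := by
  rcases (norm_nonneg (projFrame V y)).eq_or_lt with h | h
  · rw [← h]; exact norm_nonneg y
  · refine le_of_mul_le_mul_left ?_ h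
    rw [← real_inner_self_eq_norm_mul_norm, inner_projFrame]
    refine (real_inner_le_norm _ _).trans (le_of_eq ?_)
    rw [norm_liftFrame hV]

/-- On characteristic functions: `⟨t, Vᵀ x⟩ = ⟨V t, x⟩` and `‖V t‖ = ‖t‖`. This makes the projected
sample an i.i.d. sample from a Gaussian mixture in dimension `r`. -/
theorem map_projFrame_stdGaussian {V : Fin r → Euc d} (hV : Orthonormal ℝ V) :
    (stdGaussian (Euc d)).map (projFrameCLM V) = stdGaussian (Euc r) := by
  apply Measure.ext_of_charFun
  ext t
  rw [charFun_apply, integral_map (by fun_prop) (by fun_prop), charFun_stdGaussian,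
    ← norm_liftFrame hV, ← charFun_stdGaussian, charFun_apply]
  refine integral_congr_ae (ae_of_all _ fun x => ?_)
  simp only
  rw [projFrameCLM_apply, real_inner_comm, inner_projFrame, real_inner_comm]

theorem map_projFrame_gaussMix {V : Fin r → Euc d} (hV : Orthonormal ℝ V) (Γ : Measure (Euc d))
    [IsProbabilityMeasure Γ] :
    (gaussMix Γ).map (projFrame V) = gaussMix (Γ.map (projFrame V)) := by
  have h := Measure.map_conv_continuousLinearMap (μ := Γ) (ν := stdGaussian (Euc d))
    (projFrameCLM V)
  rw [map_projFrame_stdGaussian hV] at h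
  exact h

theorem map_projFrame_sampleLaw {V : Fin r → Euc d} (hV : Orthonormal ℝ V) (m : ℕ)
    (Γ : Measure (Euc d)) [IsProbabilityMeasure Γ] :
    (sampleLaw m Γ).map (fun x i => projFrame V (x i)) = sampleLaw m (Γ.map (projFrame V)) := by
  have hm : Measurable (projFrame V) := (projFrameCLM V).continuous.measurable
  have : IsProbabilityMeasure ((gaussMix Γ).map (projFrame V)) :=
    Measure.isProbabilityMeasure_map hm.aemeasurable
  rw [sampleLaw, Measure.pi_map_pi fun _ => hm.aemeasurable, map_projFrame_gaussMix hV, sampleLaw]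

end Frame

/-! ### Measurable choice of the frame -/

/-- The first nonzero vector of the list is a measurable choice. -/
theorem exists_measurable_pick {Ω E : Type*} [MeasurableSpace Ω] [Zero E] [MeasurableSpace E]
    [MeasurableSingletonClass E] {n : ℕ} (f : Fin n → Ω → E) (hf : ∀ i, Measurable (f i)) :
    ∃ g : Ω → E, Measurable g ∧ (∀ x, g x = 0 ∨ ∃ i, g x = f i x) ∧
      ∀ x, g x = 0 → ∀ i, f i x = 0 := by
  classical
  induction n with
  | zero => exact ⟨fun _ => 0, measurable_const, fun _ => Or.inl rfl, fun _ _ i => i.elim0⟩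
  | succ n ih =>
    obtain ⟨g, hg, hg1, hg2⟩ := ih (fun i => f i.succ) fun i => hf i.succ
    refine ⟨fun x => if f 0 x = 0 then g x else f 0 x,
      Measurable.ite ((hf 0) (measurableSet_singleton 0)) hg (hf 0), fun x => ?_, fun x hx => ?_⟩
    · by_cases h : f 0 x = 0
      · simp only [h, if_true]
        exact (hg1 x).imp_right fun ⟨i, hi⟩ => ⟨i.succ, hi⟩
      · simp only [h, if_false]
        exact Or.inr ⟨0, rfl⟩
    · by_cases h : f 0 x = 0
      · simp only [h, if_true] at hx
        intro i
        induction i using Fin.cases with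
        | zero => exact h
        | succ i => exact hg2 x hx i
      · simp only [h, if_false] at hx

theorem orthonormal_snoc {E : Type*} [NormedAddCommGroup E] [InnerProductSpace ℝ E] {s : ℕ}
    {V : Fin s → E} (hV : Orthonormal ℝ V) {u : E} (hu : ‖u‖ = 1) (huV : ∀ i, inner ℝ u (V i) = 0) :
    Orthonormal ℝ (Fin.snoc V u : Fin (s + 1) → E) := by
  refine ⟨fun i => ?_, fun i j hij => ?_⟩
  · induction i using Fin.lastCases with
    | last => simpa using hu
    | cast i => simpa using hV.1 i
  · induction i using Fin.lastCases with
    | last =>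
      induction j using Fin.lastCases with
      | last => exact absurd rfl hij
      | cast j => simpa using huV j
    | cast i =>
      induction j using Fin.lastCases with
      | last => simpa [real_inner_comm] using huV i
      | cast j =>
        simp only [Fin.snoc_castSucc]
        exact hV.2 fun h => hij (by rw [h])

theorem span_range_snoc {E : Type*} [AddCommGroup E] [Module ℝ E] {s : ℕ} (V : Fin s → E) (u : E) :
    Submodule.span ℝ (Set.range (Fin.snoc V u : Fin (s + 1) → E))
      = Submodule.span ℝ (Set.range V) ⊔ Submodule.span ℝ {u} := by
  rw [Fin.range_snoc, Set.insert_eq, Submodule.span_union, sup_comm]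

section Frame

variable {Ω : Type*} [MeasurableSpace Ω] {d : ℕ}

/-- Greedy Gram–Schmidt: the next vector is the first nonzero residual of a `c i`, or, once these
are exhausted, of a basis vector. The dichotomy records whether the frame is still inside the span
of the `c i` or already contains it. -/
theorem exists_measurable_frame_aux (c : Fin d → Ω → Euc d) (hc : ∀ i, Measurable (c i)) (s : ℕ)
    (hs : s ≤ d) : ∃ V : Ω → Fin s → Euc d, Measurable V ∧ (∀ x, Orthonormal ℝ (V x)) ∧
      ∀ x, Submodule.span ℝ (Set.range (V x)) ≤ Submodule.span ℝ (Set.range fun i => c i x) ∨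
        Submodule.span ℝ (Set.range fun i => c i x) ≤ Submodule.span ℝ (Set.range (V x)) := by
  classical
  induction s with
  | zero =>
    refine ⟨fun _ => Fin.elim0, measurable_const, fun x => ⟨fun i => i.elim0, fun i => i.elim0⟩,
      fun x => Or.inl ?_⟩
    simp [Set.range_eq_empty]
  | succ s ih =>
    obtain ⟨V, hVm, hV, hVS⟩ := ih (by omega)
    have hres : ∀ f : Ω → Euc d, Measurable f → Measurable fun x => frameResidual (V x) (f x) :=
      fun f hf => measurable_frameResidual.comp (hVm.prodMk hf)
    obtain ⟨g, hg, hg1, hg2⟩ := exists_measurable_pick (fun i x => frameResidual (V x) (c i x))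
      fun i => hres _ (hc i)
    obtain ⟨b, hb, hb1, hb2⟩ := exists_measurable_pick
      (fun i x => frameResidual (V x) (EuclideanSpace.basisFun (Fin d) ℝ i))
      fun i => hres _ measurable_const
    let q : Ω → Euc d := fun x => if g x = 0 then b x else g x
    have hq : Measurable q := Measurable.ite (hg (measurableSet_singleton 0)) hb hg
    -- As `s < d`, the frame cannot span the space, so some basis vector has a nonzero residual.
    have hb0 : ∀ x, b x ≠ 0 := by
      intro x hx
      have hmem : ∀ i, EuclideanSpace.basisFun (Fin d) ℝ i ∈ Submodule.span ℝ (Set.range (V x)) :=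
        fun i => (frameResidual_eq_zero_iff (hV x)).1 (hb2 x hx i)
      have htop : (⊤ : Submodule ℝ (Euc d)) ≤ Submodule.span ℝ (Set.range (V x)) := by
        rw [← (EuclideanSpace.basisFun (Fin d) ℝ).toBasis.span_eq, Submodule.span_le]
        rintro _ ⟨i, rfl⟩
        simpa using hmem i
      have h1 := finrank_range_le_card (R := ℝ) (V x)
      rw [Set.finrank, top_le_iff.1 htop, finrank_top, finrank_euclideanSpace_fin,
        Fintype.card_fin] at h1
      omega
    have hq0 : ∀ x, q x ≠ 0 := by
      intro x
      by_cases h : g x = 0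
      · simpa [q, h] using hb0 x
      · simp [q, h]
    have hqres : ∀ x, ∃ y, q x = frameResidual (V x) y := by
      intro x
      by_cases h : g x = 0
      · obtain ⟨i, hi⟩ := (hb1 x).resolve_left (hb0 x)
        exact ⟨_, by simpa [q, h] using hi⟩
      · obtain ⟨i, hi⟩ := (hg1 x).resolve_left h
        exact ⟨_, by simpa [q, h] using hi⟩
    refine ⟨fun x => Fin.snoc (V x) (‖q x‖⁻¹ • q x), ?_, fun x => ?_, fun x => ?_⟩
    · refine measurable_pi_iff.2 fun i => ?_
      induction i using Fin.lastCases with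
      | last => simp only [Fin.snoc_last]; fun_prop
      | cast i => simp only [Fin.snoc_castSucc]; fun_prop
    · refine orthonormal_snoc (hV x) ?_ fun i => ?_
      · rw [norm_smul, norm_inv, norm_norm, inv_mul_cancel₀ (norm_ne_zero_iff.2 (hq0 x))]
      · obtain ⟨y, hy⟩ := hqres x
        rw [real_inner_smul_left, hy,
          inner_frameResidual (hV x) y (Submodule.subset_span ⟨i, rfl⟩), mul_zero]
    · rw [span_range_snoc]
      rcases hVS x with h | h
      · by_cases hgx : g x = 0
        · right
          refine le_trans (Submodule.span_le.2 ?_) le_sup_left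
          rintro _ ⟨i, rfl⟩
          exact (frameResidual_eq_zero_iff (hV x)).1 (hg2 x hgx i)
        · left
          refine sup_le h ?_
          rw [Submodule.span_singleton_le_iff_mem]
          refine Submodule.smul_mem _ _ ?_
          obtain ⟨i, hi⟩ := (hg1 x).resolve_left hgx
          have : q x = frameResidual (V x) (c i x) := by simpa [q, hgx] using hi
          rw [this]
          exact Submodule.sub_mem _ (Submodule.subset_span ⟨i, rfl⟩) (h (liftFrame_mem_span _ _))
      · exact Or.inr (h.trans le_sup_left)

/-- Measurable orthonormal frames whose span contains given measurable vectors. -/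
theorem exists_measurable_frame (c : Fin d → Ω → Euc d) (hc : ∀ i, Measurable (c i)) {r : ℕ}
    (hr : r ≤ d)
    (hrank : ∀ x, Module.finrank ℝ (Submodule.span ℝ (Set.range fun i => c i x)) ≤ r) :
    ∃ V : Ω → Fin r → Euc d, Measurable V ∧ (∀ x, Orthonormal ℝ (V x)) ∧
      ∀ x, Submodule.span ℝ (Set.range fun i => c i x) ≤ Submodule.span ℝ (Set.range (V x)) := by
  obtain ⟨V, hVm, hV, hVS⟩ := exists_measurable_frame_aux c hc r hr
  refine ⟨V, hVm, hV, fun x => ?_⟩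
  rcases hVS x with h | h
  · have hfin : Module.finrank ℝ (Submodule.span ℝ (Set.range (V x))) = r := by
      rw [finrank_span_eq_card (hV x).linearIndependent, Fintype.card_fin]
    exact (Submodule.eq_of_le_of_finrank_le h (by rw [hfin]; exact hrank x)).ge
  · exact h

/-- The `i`-th column of the second moment matrix. -/
noncomputable def momentColumn (Γ : Measure (Euc d)) (i : Fin d) : Euc d :=
  ∫ y, y i • y ∂Γ

/-- The second moment matrix is a function of the measure itself, so no measurable choice of atoms
and weights is needed. -/
theorem measurable_momentColumn {F : Ω → Measure (Euc d)} (hF : Measurable F)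
    [∀ x, IsProbabilityMeasure (F x)] (i : Fin d) : Measurable fun x => momentColumn (F x) i := by
  let K : Kernel Ω (Euc d) := ⟨F, hF⟩
  have : IsMarkovKernel K := ⟨fun x => (inferInstance : IsProbabilityMeasure (F x))⟩
  have h : StronglyMeasurable fun p : Ω × Euc d => p.2 i • p.2 := by
    apply Measurable.stronglyMeasurable
    fun_prop
  exact (h.integral_kernel_prod_right' (κ := K)).measurable

theorem momentColumn_atomic {ι : Type*} [Fintype ι] {w : ι → ℝ} (hw : ∀ j, 0 ≤ w j)
    (μ : ι → Euc d) (i : Fin d) : momentColumn (atomic w μ) i = ∑ j, w j • (μ j i • μ j) := by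
  rw [momentColumn, atomic, integral_finsetSum_measure fun j _ =>
    (integrable_dirac (by simp)).smul_measure ENNReal.ofReal_ne_top]
  refine Finset.sum_congr rfl fun j _ => ?_
  rw [integral_smul_measure, integral_dirac, ENNReal.toReal_ofReal (hw j)]

theorem finrank_momentColumn_atomic_le {ι : Type*} [Fintype ι] {w : ι → ℝ} (hw : ∀ j, 0 ≤ w j)
    (μ : ι → Euc d) :
    Module.finrank ℝ (Submodule.span ℝ (Set.range (momentColumn (atomic w μ))))
      ≤ min d (Fintype.card ι) := by
  refine le_min ?_ ?_
  · simpa using Submodule.finrank_le (Submodule.span ℝ (Set.range (momentColumn (atomic w μ))))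
  · refine (Submodule.finrank_mono (Submodule.span_le.2 ?_)).trans
      (finrank_range_le_card (R := ℝ) μ)
    rintro _ ⟨i, rfl⟩
    rw [momentColumn_atomic hw]
    exact Submodule.sum_mem _ fun j _ => Submodule.smul_mem _ _ (Submodule.smul_mem _ _
      (Submodule.subset_span ⟨j, rfl⟩))

/-- Atoms of positive mass lie in the column space of the second moment matrix. -/
theorem atom_mem_span_momentColumn {ι : Type*} [Fintype ι] {w : ι → ℝ} (hw : ∀ j, 0 ≤ w j)
    (μ : ι → Euc d) {j : ι} (hj : w j ≠ 0) :
    μ j ∈ Submodule.span ℝ (Set.range (momentColumn (atomic w μ))) := by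
  set S := Submodule.span ℝ (Set.range (momentColumn (atomic w μ)))
  rw [← Submodule.orthogonal_orthogonal S, Submodule.mem_orthogonal]
  intro u hu
  rw [Submodule.mem_orthogonal'] at hu
  -- For `u` orthogonal to all the columns, the quadratic form of the moment matrix vanishes at `u`;
  -- being a sum of nonnegative terms, it vanishes atom by atom.
  have h : ∑ l, w l * inner ℝ u (μ l) ^ 2 = 0 := by
    calc ∑ l, w l * inner ℝ u (μ l) ^ 2
        = ∑ i, u i * inner ℝ u (momentColumn (atomic w μ) i) := by
          simp only [momentColumn_atomic hw, inner_sum, real_inner_smul_right, Finset.mul_sum]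
          rw [Finset.sum_comm]
          refine Finset.sum_congr rfl fun l _ => ?_
          rw [sq, ← mul_assoc, mul_comm (w l * _)]
          conv_lhs => enter [2, 2]; rw [PiLp.inner_apply]
          rw [Finset.mul_sum, Finset.mul_sum]
          refine Finset.sum_congr rfl fun i _ => ?_
          simp
          ring
      _ = 0 := Finset.sum_eq_zero fun i _ => by
          rw [hu _ (Submodule.subset_span ⟨i, rfl⟩), mul_zero]
  have := (Finset.sum_eq_zero_iff_of_nonneg fun l _ => mul_nonneg (hw l) (sq_nonneg _)).1 h j
    (Finset.mem_univ j)
  simpa [hj] using this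

theorem atomic_compl_eq_zero_iff {ι : Type*} [Fintype ι] {w : ι → ℝ} (hw : ∀ j, 0 ≤ w j)
    (μ : ι → Euc d) (S : Submodule ℝ (Euc d)) :
    atomic w μ (S : Set (Euc d))ᶜ = 0 ↔ ∀ j, w j ≠ 0 → μ j ∈ S := by
  have hS : MeasurableSet (S : Set (Euc d))ᶜ := S.closed_of_finiteDimensional.measurableSet.compl
  rw [← lintegral_indicator_one hS, lintegral_atomic _ _ (measurable_one.indicator hS),
    Finset.sum_eq_zero_iff]
  refine ⟨fun h j hj => ?_, fun h j _ => ?_⟩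
  · have := h j (Finset.mem_univ j)
    have hpos : 0 < w j := lt_of_le_of_ne (hw j) (Ne.symm hj)
    rw [mul_eq_zero, ENNReal.ofReal_eq_zero] at this
    simpa using this.resolve_left (not_le.2 hpos)
  · by_cases hj : w j = 0
    · simp [hj]
    · simp [h j hj]

end Frame

/-! ### The errors orthogonal to the frame and inside it -/

theorem isProbabilityMeasure_of_mem_atomicMixing {k d : ℕ} {R : ℝ} {Γ : Measure (Euc d)}
    (h : Γ ∈ atomicMixing k d R) : IsProbabilityMeasure Γ := by
  obtain ⟨w, μ, -, hw, hw1, rfl⟩ := h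
  exact isProbabilityMeasure_atomic μ hw hw1

/-- The only property of the Wasserstein distance that is needed: every explicit coupling bounds it
from above. -/
theorem wasserstein1_atomic_le {ι : Type*} [Fintype ι] {d : ℕ} {v w : ι → ℝ} {π : ι → ι → ℝ}
    (hπ : IsWeightCoupling v w π) (x y : ι → Euc d) :
    wasserstein1 (atomic v x) (atomic w y)
      ≤ ENNReal.ofReal (∑ i, ∑ j, π i j * ‖x i - y j‖) := by
  let P : Measure (Euc d × Euc d) :=
    ∑ i, ∑ j, ENNReal.ofReal (π i j) • Measure.dirac (x i, y j)
  have hP : ∀ f : Euc d × Euc d → ℝ≥0∞, Measurable f →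
      ∫⁻ p, f p ∂P = ∑ i, ∑ j, ENNReal.ofReal (π i j) * f (x i, y j) := fun f hf => by
    simp [P, lintegral_smul_measure, lintegral_dirac' _ hf]
  have h1 : P.map Prod.fst = atomic v x := by
    refine Measure.ext_of_lintegral _ fun f hf => ?_
    rw [lintegral_map hf measurable_fst, hP (fun p => f p.1) (hf.comp measurable_fst),
      lintegral_atomic _ _ hf]
    refine Finset.sum_congr rfl fun i _ => ?_
    simp only
    rw [← Finset.sum_mul, ← ENNReal.ofReal_sum_of_nonneg fun j _ => hπ.nonneg i j, hπ.row]
  have h2 : P.map Prod.snd = atomic w y := by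
    refine Measure.ext_of_lintegral _ fun f hf => ?_
    rw [lintegral_map hf measurable_snd, hP (fun p => f p.2) (hf.comp measurable_snd),
      lintegral_atomic _ _ hf,
      Finset.sum_comm]
    refine Finset.sum_congr rfl fun j _ => ?_
    simp only
    rw [← Finset.sum_mul, ← ENNReal.ofReal_sum_of_nonneg fun i _ => hπ.nonneg i j, hπ.col]
  refine (iInf₂_le P ⟨h1, h2⟩).trans (le_of_eq ?_)
  rw [hP _ (by fun_prop), ENNReal.ofReal_sum_of_nonneg fun i _ => Finset.sum_nonneg fun j _ =>
    mul_nonneg (hπ.nonneg i j) (norm_nonneg _)]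
  refine Finset.sum_congr rfl fun i _ => ?_
  rw [ENNReal.ofReal_sum_of_nonneg fun j _ => mul_nonneg (hπ.nonneg i j) (norm_nonneg _)]
  refine Finset.sum_congr rfl fun j _ => ?_
  rw [ENNReal.ofReal_mul (hπ.nonneg i j), edist_dist, dist_eq_norm]

/-- `eˣ + e⁻ˣ - 2 = (2 sinh (x/2))²`, and `|sinh y| ≥ |y|`. -/
theorem two_add_sq_le_exp_add_exp_neg (x : ℝ) : 2 + x ^ 2 ≤ Real.exp x + Real.exp (-x) := by
  have h1 : |x / 2| ≤ |Real.sinh (x / 2)| := by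
    rw [Real.abs_sinh]
    exact Real.self_le_sinh_iff.2 (abs_nonneg _)
  have h2 := sq_le_sq.2 h1
  have h3 : Real.exp x = Real.exp (x / 2) ^ 2 := by rw [← Real.exp_nat_mul]; congr 1; push_cast; ring
  have h4 : Real.exp (-x) = Real.exp (-(x / 2)) ^ 2 := by
    rw [← Real.exp_nat_mul]; congr 1; push_cast; ring
  have h5 : Real.exp (x / 2) * Real.exp (-(x / 2)) = 1 := by rw [← Real.exp_add]; simp
  rw [Real.sinh_eq] at h2
  nlinarith

theorem sum_mul_inner_sq_le_laplace {ι : Type*} [Fintype ι] {d : ℕ} {w : ι → ℝ}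
    (hw : ∀ j, 0 ≤ w j) (hw1 : ∑ j, w j = 1) (μ : ι → Euc d) (u : Euc d) :
    ∑ j, w j * inner ℝ u (μ j) ^ 2 ≤ laplace w μ u + laplace w μ (-u) - 2 := by
  rw [laplace, laplace, ← Finset.sum_add_distrib, le_sub_iff_add_le]
  calc _ = ∑ j, w j * (2 + inner ℝ u (μ j) ^ 2) := by
        simp only [mul_add, Finset.sum_add_distrib, ← Finset.sum_mul, hw1]
        ring
    _ ≤ _ := by
        refine Finset.sum_le_sum fun j _ => ?_
        rw [← mul_add, inner_neg_left]
        exact mul_le_mul_of_nonneg_left (two_add_sq_le_exp_add_exp_neg _) (hw j)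

section Stage

variable {d r k : ℕ} {R : ℝ} {w v : Fin k → ℝ} {μ : Fin k → Euc d}

/-- The mean distance to the span of the frame, when the span contains the atoms of a mixing
distribution whose Gaussian mixture is Hellinger-close. -/
theorem sum_mul_norm_frameResidual_le (hR : 0 ≤ R)
    (hw : ∀ j, 0 ≤ w j) (hw1 : ∑ j, w j = 1) (hμ : ∀ j, ‖μ j‖ ≤ R)
    (hv : ∀ j, 0 ≤ v j) (hv1 : ∑ j, v j = 1) {ν : Fin k → Euc d} (hν : ∀ j, ‖ν j‖ ≤ R)
    {V : Fin r → Euc d} (hV : Orthonormal ℝ V)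
    (hspan : ∀ j, v j ≠ 0 → ν j ∈ Submodule.span ℝ (Set.range V)) :
    ∑ j, w j * ‖frameResidual V (μ j)‖
      ≤ √(2 * (2 * Real.exp (R + 1 / 2)) * k) *
        √(hellinger (gaussMix (atomic v ν)) (gaussMix (atomic w μ))).toReal := by
  set B := 2 * Real.exp (R + 1 / 2) with hB
  set H := (hellinger (gaussMix (atomic v ν)) (gaussMix (atomic w μ))).toReal
  have hH : 0 ≤ H := ENNReal.toReal_nonneg
  have hj : ∀ j, w j * ‖frameResidual V (μ j)‖ ^ 2 ≤ 2 * B * H := by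
    intro j
    by_cases h0 : frameResidual V (μ j) = 0
    · rw [h0]; simp; positivity
    set ρ := ‖frameResidual V (μ j)‖ with hρ
    have hρ0 : ρ ≠ 0 := norm_ne_zero_iff.2 h0
    -- A separate direction for each atom: along the normalized residual of `μ j`, the second moment
    -- includes the term `w j ρ²`.
    set u := ρ⁻¹ • frameResidual V (μ j) with hu
    have hu1 : ‖u‖ = 1 := by
      rw [hu, norm_smul, norm_inv, hρ, norm_norm, inv_mul_cancel₀ hρ0]
    have huV : ∀ x ∈ Submodule.span ℝ (Set.range V), inner ℝ u x = 0 := fun x hx => by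
      rw [hu, real_inner_smul_left, inner_frameResidual hV _ hx, mul_zero]
    have huμ : inner ℝ u (μ j) = ρ := by
      rw [hu, real_inner_smul_left, inner_frameResidual_self hV, ← hρ]
      field_simp
    have hlap : ∀ s : Euc d, (∀ x ∈ Submodule.span ℝ (Set.range V), inner ℝ s x = 0) →
        laplace v ν s = 1 := by
      intro s hs
      rw [← hv1, laplace]
      refine Finset.sum_congr rfl fun i _ => ?_
      by_cases hi : v i = 0
      · simp [hi]
      · rw [hs _ (hspan i hi), Real.exp_zero, mul_one]
    have h1 := abs_laplace_sub_le_hellinger hR hv hv1 hν hw hw1 hμ hu1.le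
    have h2 := abs_laplace_sub_le_hellinger hR hv hv1 hν hw hw1 hμ (s := -u) (by simp [hu1])
    rw [hlap u huV, abs_sub_comm] at h1
    rw [hlap (-u) (fun x hx => by rw [inner_neg_left, huV x hx, neg_zero]), abs_sub_comm] at h2
    have h3 := sum_mul_inner_sq_le_laplace hw hw1 μ u
    have h4 := Finset.single_le_sum (f := fun i => w i * inner ℝ u (μ i) ^ 2)
      (fun i _ => mul_nonneg (hw i) (sq_nonneg _)) (Finset.mem_univ j)
    simp only [huμ] at h4
    have h5 := (le_abs_self _).trans h1
    have h6 := (le_abs_self _).trans h2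
    linarith
  have hsum : ∑ j, w j * ‖frameResidual V (μ j)‖ ^ 2 ≤ 2 * B * k * H := by
    refine (Finset.sum_le_sum fun j _ => hj j).trans (le_of_eq ?_)
    simp; ring
  rw [← Real.sqrt_mul (by positivity)]
  refine Real.le_sqrt_of_sq_le ?_
  calc (∑ j, w j * ‖frameResidual V (μ j)‖) ^ 2
      ≤ (∑ j, w j) * ∑ j, w j * ‖frameResidual V (μ j)‖ ^ 2 :=
        Finset.sum_sq_le_sum_mul_sum_of_sq_le_mul _ (fun j _ => hw j)
          (fun j _ => mul_nonneg (hw j) (sq_nonneg _)) (fun j _ => (by ring : _ = _).le)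
    _ ≤ 2 * B * k * H := by rw [hw1, one_mul]; exact hsum

/-- `V ν - μ = V (ν - Vᵀ μ) - (residual of μ)`, and `V` is an isometry. The coupling is built in
`ℝ^r`, so the random direction costs `√r` instead of `√d`. -/
theorem wasserstein1_map_liftFrame_le (hk : 0 < k) (hr : 0 < r) (hR : 0 ≤ R)
    (hw : ∀ j, 0 ≤ w j) (hw1 : ∑ j, w j = 1) (hμ : ∀ j, ‖μ j‖ ≤ R)
    {γ : Measure (Euc r)} (hγ : γ ∈ atomicMixing k r R) {V : Fin r → Euc d}
    (hV : Orthonormal ℝ V) :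
    wasserstein1 (γ.map (liftFrame V)) (atomic w μ)
      ≤ ENNReal.ofReal (∑ j, w j * ‖frameResidual V (μ j)‖)
        + ENNReal.ofReal (32 * k ^ 4 * √r * (Real.exp R * (1 + Real.exp R)) *
            (2 * Real.exp (R + 1 / 2)) ^ (1 / (2 * (k : ℝ) - 1)))
          * hellinger (gaussMix γ) (gaussMix ((atomic w μ).map (projFrame V)))
            ^ (1 / (2 * (k : ℝ) - 1)) := by
  obtain ⟨v, ν, hν, hv, hv1, hγeq⟩ := hγ
  replace hγeq : γ = atomic v ν := hγeq
  have hk1 : (1 : ℝ) ≤ k := by exact_mod_cast hk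
  have hp : 0 ≤ 1 / (2 * (k : ℝ) - 1) := by
    apply div_nonneg <;> linarith
  have hlift : Measurable (liftFrame V) :=
    measurable_liftFrame.comp (measurable_const.prodMk measurable_id)
  have hproj : Measurable (projFrame V) := (projFrameCLM V).continuous.measurable
  have hμ' : ∀ j, ‖projFrame V (μ j)‖ ≤ R := fun j => (norm_projFrame_le hV _).trans (hμ j)
  obtain ⟨π, hπ, hcost⟩ := exists_coupling_le_hellinger hk hr hR hv hv1 hν hw hw1 hμ'
  rw [hγeq, map_atomic _ _ hlift, map_atomic _ _ hproj]
  have := isProbabilityMeasure_atomic ν hv hv1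
  have := isProbabilityMeasure_atomic (fun j => projFrame V (μ j)) hw hw1
  set Hell := hellinger (gaussMix (atomic v ν))
    (gaussMix (atomic w fun j => projFrame V (μ j))) with hHell
  have hne : Hell ≠ ⊤ := hellinger_ne_top
  have hHell' : Hell = ENNReal.ofReal Hell.toReal := (ENNReal.ofReal_toReal hne).symm
  rw [hHell', ENNReal.ofReal_rpow_of_nonneg ENNReal.toReal_nonneg hp,
    ← ENNReal.ofReal_mul (by positivity), ← ENNReal.ofReal_add
      (Finset.sum_nonneg fun j _ => mul_nonneg (hw j) (norm_nonneg _)) (by positivity)]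
  refine (wasserstein1_atomic_le hπ _ _).trans (ENNReal.ofReal_le_ofReal ?_)
  calc ∑ i, ∑ j, π i j * ‖liftFrame V (ν i) - μ j‖
      ≤ ∑ i, ∑ j, (π i j * ‖frameResidual V (μ j)‖ + π i j * ‖ν i - projFrame V (μ j)‖) := by
        refine Finset.sum_le_sum fun i _ => Finset.sum_le_sum fun j _ => ?_
        rw [← mul_add]
        refine mul_le_mul_of_nonneg_left ?_ (hπ.nonneg i j)
        rw [← norm_liftFrame hV (ν i - projFrame V (μ j)), liftFrame_sub, add_comm]
        refine le_trans (le_of_eq ?_) (norm_sub_le _ _)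
        congr 1
        rw [frameResidual]
        abel
    _ = ∑ j, w j * ‖frameResidual V (μ j)‖ + ∑ i, ∑ j, π i j * ‖ν i - projFrame V (μ j)‖ := by
        simp only [Finset.sum_add_distrib]
        congr 1
        rw [Finset.sum_comm]
        simp only [← Finset.sum_mul, hπ.col]
    _ ≤ _ := by
        refine add_le_add_right (hcost.trans (le_of_eq ?_)) _
        rw [Real.mul_rpow (by positivity) ENNReal.toReal_nonneg]
        ring

end Stage

/-! ### The two-stage estimator -/

/-- The two-stage estimator with an explicit risk bound. -/
theorem exists_twoStage_estimator {k d m N : ℕ} (hk : 0 < k) (hd : 0 < d) (h : 2 * m ≤ N)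
    {R c : ℝ} (hR : 0 ≤ R) (F : (d' : ℕ) → (Fin m → Euc d') → Measure (Euc d'))
    (hF : ∀ d', 1 ≤ d' → IsProperDensityEstimator k d' m R c (F d')) :
    ∃ G : (Fin N → Euc d) → Measure (Euc d), IsMixingEstimator k d N R G ∧ IsTwoStage k h F G ∧
      ∀ Γ ∈ atomicMixing k d R, ∫⁻ X, wasserstein1 (G X) Γ ∂(sampleLaw N Γ)
        ≤ ENNReal.ofReal √(2 * (2 * Real.exp (R + 1 / 2)) * k)
            * ENNReal.ofReal (c * ((d : ℝ) / m) ^ (1 / 2 : ℝ)) ^ (1 / 2 : ℝ)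
          + ENNReal.ofReal (32 * k ^ 4 * √(min d k : ℕ) * (Real.exp R * (1 + Real.exp R)) *
            (2 * Real.exp (R + 1 / 2)) ^ (1 / (2 * (k : ℝ) - 1)))
            * ENNReal.ofReal (c * (((min d k : ℕ) : ℝ) / m) ^ (1 / 2 : ℝ))
              ^ (1 / (2 * (k : ℝ) - 1)) := by
  set r := min d k with hr
  have hr0 : 0 < r := lt_min hd hk
  have hk1 : (1 : ℝ) ≤ k := by exact_mod_cast hk
  have hFd := hF d hd
  have hFr := hF r hr0
  have hprobd : ∀ x, IsProbabilityMeasure (F d x) := fun x =>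
    isProbabilityMeasure_of_mem_atomicMixing (hFd.estimator.mem x)
  have hprobr : ∀ x, IsProbabilityMeasure (F r x) := fun x =>
    isProbabilityMeasure_of_mem_atomicMixing (hFr.estimator.mem x)
  obtain ⟨V, hVm, hV, hVspan⟩ := exists_measurable_frame
    (fun i x => momentColumn (F d x) i) (fun i => measurable_momentColumn hFd.estimator.measurable i)
    (r := r) (min_le_left _ _) (fun x => by
      obtain ⟨v, ν, -, hv, -, hx⟩ := hFd.estimator.mem x
      have := finrank_momentColumn_atomic_le hv ν
      rw [Fintype.card_fin] at this
      rw [hx]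
      exact this)
  have hatoms : ∀ x (v : Fin k → ℝ) (ν : Fin k → Euc d), (∀ j, 0 ≤ v j) → F d x = atomic v ν →
      ∀ j, v j ≠ 0 → ν j ∈ Submodule.span ℝ (Set.range (V x)) := by
    intro x v ν hv hx j hj
    apply hVspan x
    simp only [hx]
    exact atom_mem_span_momentColumn hv ν hj
  have hfirst : Measurable (firstHalf h : (Fin N → Euc d) → _) := by
    unfold firstHalf; fun_prop
  have hsecond : Measurable (secondHalf h : (Fin N → Euc d) → _) := by
    unfold secondHalf; fun_prop
  have hprojm : Measurable fun p : (Fin m → Euc d) × (Fin m → Euc d) =>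
      fun i => projFrame (V p.1) (p.2 i) :=
    measurable_pi_iff.2 fun i => measurable_projFrame.comp
      ((hVm.comp measurable_fst).prodMk ((measurable_pi_apply i).comp measurable_snd))
  let G : (Fin N → Euc d) → Measure (Euc d) := fun X =>
    (F r (fun i => projFrame (V (firstHalf h X)) (secondHalf h X i))).map
      (liftFrame (V (firstHalf h X)))
  refine ⟨G, ⟨?_, ?_⟩, ⟨V, hVm, hV, fun x => ?_, fun X => rfl⟩, fun Γ hΓ => ?_⟩
  · refine measurable_map_kernel (κ := fun X =>
      F r (fun i => projFrame (V (firstHalf h X)) (secondHalf h X i)))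
      (hFr.estimator.measurable.comp (hprojm.comp (hfirst.prodMk hsecond)))
      (f := fun X => liftFrame (V (firstHalf h X))) ?_
    exact measurable_liftFrame.comp (((hVm.comp hfirst).comp measurable_fst).prodMk measurable_snd)
  · intro X
    obtain ⟨v, ν, hν, hv, hv1, hx⟩ := hFr.estimator.mem
      (fun i => projFrame (V (firstHalf h X)) (secondHalf h X i))
    refine ⟨v, fun j => liftFrame (V (firstHalf h X)) (ν j), fun j => ?_, hv, hv1, ?_⟩
    · rw [norm_liftFrame (hV _)]; exact hν j
    · simp only [G, hx]
      exact map_atomic v ν (measurable_liftFrame.comp (measurable_const.prodMk measurable_id))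
  · obtain ⟨v, ν, -, hv, -, hx⟩ := hFd.estimator.mem x
    rw [hx]
    exact (atomic_compl_eq_zero_iff hv ν _).2 (hatoms x v ν hv hx)
  · have hprobΓ := isProbabilityMeasure_of_mem_atomicMixing hΓ
    have hΓ' := hΓ
    obtain ⟨w, μ, hμ, hw, hw1, hΓeq⟩ := hΓ
    replace hΓeq : Γ = atomic w μ := hΓeq
    set p : ℝ := 1 / (2 * (k : ℝ) - 1) with hp
    have hp0 : 0 < p := by apply div_pos <;> linarith
    have hp1 : p ≤ 1 := by
      rw [hp, div_le_one] <;> linarith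
    set A := ENNReal.ofReal (32 * k ^ 4 * √r * (Real.exp R * (1 + Real.exp R)) *
            (2 * Real.exp (R + 1 / 2)) ^ p) with hA
    set B := ENNReal.ofReal √(2 * (2 * Real.exp (R + 1 / 2)) * k) with hB
    have hprojV : ∀ x, Measurable (projFrame (V x)) :=
      fun x => (projFrameCLM (V x)).continuous.measurable
    have hprobproj : ∀ x, IsProbabilityMeasure (Γ.map (projFrame (V x))) := fun x =>
      Measure.isProbabilityMeasure_map (hprojV x).aemeasurable
    have hmemproj : ∀ x, Γ.map (projFrame (V x)) ∈ atomicMixing k r R := fun x =>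
      ⟨w, fun j => projFrame (V x) (μ j), fun j => (norm_projFrame_le (hV x) _).trans (hμ j), hw,
        hw1, by rw [hΓeq]; exact map_atomic w μ (hprojV x)⟩
    let D : (Fin m → Euc d) → ℝ≥0∞ := fun x =>
      ENNReal.ofReal (∑ j, w j * ‖frameResidual (V x) (μ j)‖)
    let H : (Fin m → Euc d) × (Fin m → Euc d) → ℝ≥0∞ := fun q =>
      hellinger (gaussMix (F r fun i => projFrame (V q.1) (q.2 i)))
        (gaussMix (Γ.map (projFrame (V q.1))))
    have hD : Measurable D := by
      refine Measurable.ennreal_ofReal (Finset.measurable_fun_sum _ fun j _ => ?_)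
      exact (measurable_frameResidual.comp (hVm.prodMk measurable_const)).norm.const_mul _
    have hH : Measurable H := by
      refine measurable_hellinger (measurable_gaussMix (hFr.estimator.measurable.comp hprojm))
        (measurable_gaussMix (measurable_map_kernel (κ := fun _ => Γ) measurable_const
          (f := fun q : (Fin m → Euc d) × (Fin m → Euc d) => projFrame (V q.1)) ?_))
      exact measurable_projFrame.comp
        (((hVm.comp measurable_fst).comp measurable_fst).prodMk measurable_snd)
    have hprobS : IsProbabilityMeasure (sampleLaw m Γ) := by unfold sampleLaw; infer_instance
    have hstage1 : ∫⁻ x, D x ∂(sampleLaw m Γ)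
        ≤ B * ENNReal.ofReal (c * ((d : ℝ) / m) ^ (1 / 2 : ℝ)) ^ (1 / 2 : ℝ) := by
      have hmeas : Measurable fun x => hellinger (gaussMix (F d x)) (gaussMix Γ) :=
        measurable_hellinger (measurable_gaussMix hFd.estimator.measurable) measurable_const
      calc ∫⁻ x, D x ∂(sampleLaw m Γ)
          ≤ ∫⁻ x, B * hellinger (gaussMix (F d x)) (gaussMix Γ) ^ (1 / 2 : ℝ)
            ∂(sampleLaw m Γ) := by
            refine lintegral_mono fun x => ?_
            obtain ⟨v, ν, hν, hv, hv1, hx⟩ := hFd.estimator.mem x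
            replace hx : F d x = atomic v ν := hx
            have := sum_mul_norm_frameResidual_le hR hw hw1 hμ hv hv1 hν (hV x)
              (hatoms x v ν hv hx)
            rw [← hΓeq, ← hx] at this
            refine (ENNReal.ofReal_le_ofReal this).trans (le_of_eq ?_)
            rw [ENNReal.ofReal_mul (Real.sqrt_nonneg _), Real.sqrt_eq_rpow (hellinger _ _).toReal,
              ← ENNReal.ofReal_rpow_of_nonneg ENNReal.toReal_nonneg (by norm_num),
              ENNReal.ofReal_toReal hellinger_ne_top]
        _ = B * ∫⁻ x, hellinger (gaussMix (F d x)) (gaussMix Γ) ^ (1 / 2 : ℝ)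
            ∂(sampleLaw m Γ) := lintegral_const_mul _ (hmeas.pow_const _)
        _ ≤ B * (∫⁻ x, hellinger (gaussMix (F d x)) (gaussMix Γ) ∂(sampleLaw m Γ))
              ^ (1 / 2 : ℝ) := by
            gcongr
            exact lintegral_rpow_le_rpow_lintegral hmeas (by norm_num) (by norm_num)
        _ ≤ _ := by
            gcongr
            exact hFd.risk Γ hΓ'
    -- With the first half frozen at `x`, the frame is deterministic, and the risk bound in
    -- dimension `r` applies to the projected mixing distribution.
    have hstage2 : ∀ x, ∫⁻ y, H (x, y) ^ p ∂(sampleLaw m Γ)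
        ≤ ENNReal.ofReal (c * ((r : ℝ) / m) ^ (1 / 2 : ℝ)) ^ p := by
      intro x
      refine (lintegral_rpow_le_rpow_lintegral (hH.comp measurable_prodMk_left) hp0 hp1).trans ?_
      refine ENNReal.rpow_le_rpow (le_trans (le_of_eq ?_) (hFr.risk _ (hmemproj x))) hp0.le
      rw [← map_projFrame_sampleLaw (hV x) m Γ, lintegral_map]
      · rfl
      · exact measurable_hellinger (measurable_gaussMix hFr.estimator.measurable) measurable_const
      · exact measurable_pi_iff.2 fun i => (hprojV x).comp (measurable_pi_apply i)
    calc ∫⁻ X, wasserstein1 (G X) Γ ∂(sampleLaw N Γ)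
        ≤ ∫⁻ X, (fun q : (Fin m → Euc d) × (Fin m → Euc d) => D q.1 + A * H q ^ p)
            (firstHalf h X, secondHalf h X) ∂(sampleLaw N Γ) := by
          -- Monotonicity of the lower integral spares a proof that the Wasserstein loss is
          -- measurable; the majorant is.
          refine lintegral_mono fun X => ?_
          have := wasserstein1_map_liftFrame_le hk hr0 hR hw hw1 hμ
            (hFr.estimator.mem (fun i => projFrame (V (firstHalf h X)) (secondHalf h X i)))
            (hV (firstHalf h X))
          rw [← hΓeq] at this
          exact this
      _ = ∫⁻ q, (D q.1 + A * H q ^ p) ∂((sampleLaw m Γ).prod (sampleLaw m Γ)) := by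
          rw [← map_halves_sampleLaw h Γ]
          exact (lintegral_map ((hD.comp measurable_fst).add ((hH.pow_const p).const_mul A))
            (hfirst.prodMk hsecond)).symm
      _ = ∫⁻ x, ∫⁻ y, (D x + A * H (x, y) ^ p) ∂(sampleLaw m Γ) ∂(sampleLaw m Γ) :=
          lintegral_prod _ ((hD.comp measurable_fst).add
            ((hH.pow_const p).const_mul A)).aemeasurable
      _ ≤ ∫⁻ x, (D x + A * ENNReal.ofReal (c * ((r : ℝ) / m) ^ (1 / 2 : ℝ)) ^ p)
            ∂(sampleLaw m Γ) := by
          refine lintegral_mono fun x => ?_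
          rw [lintegral_add_left measurable_const, lintegral_const, measure_univ, mul_one,
            lintegral_const_mul (f := fun y => H (x, y) ^ p) _
              ((hH.comp measurable_prodMk_left).pow_const p)]
          gcongr
          exact hstage2 x
      _ = ∫⁻ x, D x ∂(sampleLaw m Γ) + A * ENNReal.ofReal (c * ((r : ℝ) / m) ^ (1 / 2 : ℝ)) ^ p := by
          rw [lintegral_add_right _ measurable_const, lintegral_const, measure_univ, mul_one]
      _ ≤ _ := by gcongr

/-! ### A lower bound on the risk constant, and the trivial estimator -/

theorem dirac_mem_atomicMixing {k d : ℕ} (hk : 0 < k) {R : ℝ} {x : Euc d} (hx : ‖x‖ ≤ R) :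
    Measure.dirac x ∈ atomicMixing k d R := by
  have hk' : (k : ℝ) ≠ 0 := by positivity
  refine ⟨fun _ => (k : ℝ)⁻¹, fun _ => x, fun _ => hx, fun _ => by positivity, by simp [hk'], ?_⟩
  rw [← Finset.sum_smul, ← ENNReal.ofReal_sum_of_nonneg fun _ _ => by positivity]
  simp [hk']

theorem pi_fin_one {α : Type*} [MeasurableSpace α] (μ : Measure α) [SigmaFinite μ] :
    (Measure.pi fun _ : Fin 1 => μ) = μ.map fun t _ => t := by
  refine Measure.pi_eq fun s hs => ?_
  rw [Measure.map_apply (by fun_prop) (.univ_pi hs)]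
  have : (fun (t : α) (_ : Fin 1) => t) ⁻¹' Set.univ.pi s = s 0 := by ext; simp [Fin.forall_fin_one]
  rw [this]
  simp

/-- The inclusion of `ℝ` into samples of size one in dimension one. -/
noncomputable def oneSample (t : ℝ) : Fin 1 → Euc 1 := fun _ => WithLp.toLp 2 fun _ => t

theorem sampleLaw_one_dirac (a : ℝ) :
    sampleLaw 1 (Measure.dirac (WithLp.toLp 2 fun _ => a : Euc 1))
      = (gaussianReal a 1).map oneSample := by
  have hj : Measurable fun t : ℝ => (WithLp.toLp 2 fun _ => t : Euc 1) := by fun_prop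
  have h1 : stdGaussian (Euc 1) = (gaussianReal 0 1).map fun t => (WithLp.toLp 2 fun _ => t : Euc 1) := by
    rw [← map_pi_eq_stdGaussian, pi_fin_one, Measure.map_map (by fun_prop) (by fun_prop)]
    rfl
  have h2 : gaussMix (Measure.dirac (WithLp.toLp 2 fun _ => a : Euc 1))
      = (gaussianReal a 1).map fun t => (WithLp.toLp 2 fun _ => t : Euc 1) := by
    have h3 := gaussianReal_map_const_add (μ := 0) (v := 1) a
    rw [zero_add] at h3
    rw [gaussMix, Measure.dirac_conv, h1, Measure.map_map (by fun_prop) hj, ← h3,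
      Measure.map_map hj (by fun_prop)]
    rfl
  have := Measure.isProbabilityMeasure_map (μ := gaussianReal a 1) hj.aemeasurable
  rw [sampleLaw, h2, pi_fin_one, Measure.map_map (by fun_prop) hj]
  rfl

/-- The constant of a uniform Hellinger risk bound cannot be small: two points at distance `R`
are not perfectly distinguished by one observation. -/
theorem exists_pos_le_of_isProperDensityEstimator {R : ℝ} (hR : 0 < R) :
    ∃ c₀ : ℝ, 0 < c₀ ∧ ∀ (k : ℕ), 0 < k → ∀ (c : ℝ) (G : (Fin 1 → Euc 1) → Measure (Euc 1)),
      IsProperDensityEstimator k 1 1 R c G → c₀ ≤ c := by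
  let x : ℝ → Euc 1 := fun a => WithLp.toLp 2 fun _ => a
  have hxn : ∀ a, ‖x a‖ = |a| := fun a => by simp [x, EuclideanSpace.norm_eq, Real.sqrt_sq_eq_abs]
  have hxi : ∀ a b, inner ℝ (x a) (x b) = a * b := fun a b => by
    simp [x, PiLp.inner_apply, mul_comm]
  let P : ℝ → Measure (Fin 1 → Euc 1) := fun a => sampleLaw 1 (Measure.dirac (x a))
  have hP : ∀ a, P a = (gaussianReal a 1).map oneSample := sampleLaw_one_dirac
  have hone : Measurable oneSample := by unfold oneSample; fun_prop
  have hprob : ∀ a, IsProbabilityMeasure (P a) := fun a => by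
    rw [hP]; exact Measure.isProbabilityMeasure_map hone.aemeasurable
  -- The common part of the two sample laws. It is nonzero because the Gaussians are mutually
  -- absolutely continuous, and its mass depends on `R` alone, not on `k`.
  set ν : Measure (Fin 1 → Euc 1) := P 0 ⊓ P R with hν
  have hν0 : ν ≠ 0 := by
    intro h0
    have hac : P 0 ≪ P R := by
      rw [hP, hP]
      exact ((gaussianReal_absolutelyContinuous 0 one_ne_zero).trans
        (gaussianReal_absolutelyContinuous' R one_ne_zero)).map hone
    have hms : P 0 ⟂ₘ P R := by
      rw [Measure.mutuallySingular_iff_disjoint, disjoint_iff]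
      exact h0
    have := Measure.eq_zero_of_absolutelyContinuous_of_mutuallySingular hac hms
    exact IsProbabilityMeasure.ne_zero (P 0) this
  have hνfin : IsFiniteMeasure ν := isFiniteMeasure_of_le (P 0) inf_le_left
  set B := 2 * Real.exp (R + 1 / 2) with hB
  have hBpos : 0 < B := by positivity
  have hexp : 0 < Real.exp R - 1 := by
    have := Real.add_one_lt_exp hR.ne'
    linarith
  set η := (Real.exp R - 1) / B with hη
  have hηpos : 0 < η := by positivity
  have : NeZero ν := ⟨hν0⟩
  have hmass : 0 < ν.real Set.univ := measureReal_univ_pos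
  refine ⟨η * ν.real Set.univ / 2, by positivity, fun k hk c G hG => ?_⟩
  have hmem : ∀ a, |a| ≤ R → Measure.dirac (x a) ∈ atomicMixing k 1 R := fun a ha =>
    dirac_mem_atomicMixing hk (by rw [hxn]; exact ha)
  have hprobG : ∀ X, IsProbabilityMeasure (G X) := fun X =>
    isProbabilityMeasure_of_mem_atomicMixing (hG.estimator.mem X)
  let H : ℝ → (Fin 1 → Euc 1) → ℝ≥0∞ := fun a X =>
    hellinger (gaussMix (G X)) (gaussMix (Measure.dirac (x a)))
  have hHm : ∀ a, Measurable (H a) := fun a =>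
    measurable_hellinger (measurable_gaussMix hG.estimator.measurable) measurable_const
  -- No fit is close to both points: its transform at `x 1` would have to be near both `1` and `exp
  -- R`.
  have hHlow : ∀ X, ENNReal.ofReal η ≤ H 0 X + H R X := by
    intro X
    obtain ⟨v, ξ, hξ, hv, hv1, hX⟩ := hG.estimator.mem X
    replace hX : G X = atomic v ξ := hX
    have hlap : ∀ a, |a| ≤ R →
        |laplace v ξ (x 1) - Real.exp a| ≤ B * (H a X).toReal := by
      intro a ha
      obtain ⟨w, μ, hμ, hw, hw1, hΓ⟩ := hmem a ha
      replace hΓ : Measure.dirac (x a) = atomic w μ := hΓ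
      have h1 := abs_laplace_sub_le_hellinger hR.le hv hv1 hξ hw hw1 hμ (s := x 1)
        (by rw [hxn]; simp)
      have h2 : laplace w μ (x 1) = Real.exp a := by
        have h3 := lintegral_atomic w μ
          (f := fun y => ENNReal.ofReal (Real.exp (inner ℝ (x 1) y))) (by fun_prop)
        rw [← hΓ, lintegral_dirac' _ (by fun_prop), hxi, one_mul] at h3
        simp_rw [← ENNReal.ofReal_mul (hw _)] at h3
        rw [← ENNReal.ofReal_sum_of_nonneg fun j _ =>
          mul_nonneg (hw j) (Real.exp_nonneg _)] at h3
        exact ((ENNReal.ofReal_eq_ofReal_iff (Real.exp_nonneg _) (laplace_nonneg hw _ _)).1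
          h3).symm
      rw [h2, ← hX, ← hΓ] at h1
      exact h1
    have h0 := hlap 0 (by simpa using hR.le)
    have h1 := hlap R (by rw [abs_of_pos hR])
    rw [Real.exp_zero] at h0
    have h2 : Real.exp R - 1 ≤ B * ((H 0 X).toReal + (H R X).toReal) := by
      have h3 := (abs_le.1 h0).2
      have h4 := (abs_le.1 h1).1
      linarith
    have hne : ∀ a, H a X ≠ ⊤ := fun a => hellinger_ne_top
    rw [← ENNReal.ofReal_toReal (hne 0), ← ENNReal.ofReal_toReal (hne R),
      ← ENNReal.ofReal_add ENNReal.toReal_nonneg ENNReal.toReal_nonneg]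
    refine ENNReal.ofReal_le_ofReal ?_
    rw [hη, div_le_iff₀ hBpos]
    linarith
  have hrisk : ∀ a, |a| ≤ R → ∫⁻ X, H a X ∂(P a) ≤ ENNReal.ofReal c := fun a ha => by
    simpa using hG.risk _ (hmem a ha)
  have hmain : ENNReal.ofReal (η * ν.real Set.univ) ≤ ENNReal.ofReal c + ENNReal.ofReal c := by
    calc ENNReal.ofReal (η * ν.real Set.univ) = ∫⁻ _, ENNReal.ofReal η ∂ν := by
          rw [lintegral_const, ENNReal.ofReal_mul hηpos.le, ofReal_measureReal]
      _ ≤ ∫⁻ X, (H 0 X + H R X) ∂ν := lintegral_mono hHlow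
      _ = ∫⁻ X, H 0 X ∂ν + ∫⁻ X, H R X ∂ν := lintegral_add_left (hHm 0) _
      _ ≤ ∫⁻ X, H 0 X ∂(P 0) + ∫⁻ X, H R X ∂(P R) :=
          add_le_add (lintegral_mono' inf_le_left le_rfl) (lintegral_mono' inf_le_right le_rfl)
      _ ≤ _ := add_le_add (hrisk 0 (by simpa using hR.le)) (hrisk R (by rw [abs_of_pos hR]))
  have hc0 : 0 ≤ c := by
    by_contra hc
    rw [ENNReal.ofReal_of_nonpos (not_le.1 hc).le, add_zero, nonpos_iff_eq_zero,
      ENNReal.ofReal_eq_zero] at hmain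
    have : 0 < η * ν.real Set.univ := by positivity
    linarith
  rw [← ENNReal.ofReal_add hc0 hc0, ENNReal.ofReal_le_ofReal_iff (by positivity)] at hmain
  linarith

theorem wasserstein1_dirac_zero_le {k d : ℕ} {R : ℝ} {Γ : Measure (Euc d)}
    (hΓ : Γ ∈ atomicMixing k d R) : wasserstein1 (Measure.dirac 0) Γ ≤ ENNReal.ofReal R := by
  obtain ⟨w, μ, hμ, hw, hw1, hΓeq⟩ := hΓ
  replace hΓeq : Γ = atomic w μ := hΓeq
  have hπ : IsWeightCoupling w w fun i j => if i = j then w i else 0 :=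
    ⟨fun i j => by split_ifs; exacts [hw i, le_rfl], fun i => by simp, fun j => by simp⟩
  have h0 : (Measure.dirac 0 : Measure (Euc d)) = atomic w fun _ => 0 := by
    rw [atomic, ← Finset.sum_smul, ← ENNReal.ofReal_sum_of_nonneg fun j _ => hw j, hw1]
    simp
  rw [h0, hΓeq]
  refine (wasserstein1_atomic_le hπ _ _).trans (ENNReal.ofReal_le_ofReal ?_)
  calc ∑ i, ∑ j, (if i = j then w i else 0) * ‖0 - μ j‖ = ∑ i, w i * ‖μ i‖ := by
        simp [ite_mul]
    _ ≤ ∑ i, w i * R := Finset.sum_le_sum fun i _ => mul_le_mul_of_nonneg_left (hμ i) (hw i)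
    _ = R := by rw [← Finset.sum_mul, hw1, one_mul]

/-! ### Arithmetic of the rates -/

section Rate

variable {k d m n : ℕ} {R c C : ℝ}

/-- The condition `n ≤ 3 * m` covers both `m = n` and `m = ⌊n/2⌋` with `n ≥ 2`. Only a factor `√(C
k)` arises; it is at most `(C k)^{k/2}` since `C k ≥ 1`. -/
theorem stage_one_rate_le (hk : 0 < k) (hm : 0 < m) (hn : 0 < n) (hmn : n ≤ 3 * m) (hc : 0 < c)
    {B : ℝ} (hB : 0 ≤ B) (hC : 6 * B ≤ C) (hC1 : 1 ≤ C) :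
    √(2 * B * k) * (c * ((d : ℝ) / m) ^ (1 / 2 : ℝ)) ^ (1 / 2 : ℝ)
      ≤ (C * k) ^ ((k : ℝ) / 2) * √c * ((d : ℝ) / n) ^ (1 / 4 : ℝ) := by
  have hk1 : (1 : ℝ) ≤ k := by exact_mod_cast hk
  have hm' : (0 : ℝ) < m := by exact_mod_cast hm
  have hn' : (0 : ℝ) < n := by exact_mod_cast hn
  have hmn' : (n : ℝ) ≤ 3 * m := by exact_mod_cast hmn
  have hdm : (d : ℝ) / m ≤ 3 * (d / n) := by
    rw [← mul_div_assoc, div_le_div_iff₀ hm' hn']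
    nlinarith [(Nat.cast_nonneg d : (0 : ℝ) ≤ d)]
  have h3 : (3 : ℝ) ^ (1 / 4 : ℝ) ≤ √3 := by
    rw [Real.sqrt_eq_rpow]
    exact Real.rpow_le_rpow_of_exponent_le (by norm_num) (by norm_num)
  have hCk : 1 ≤ C * k := one_le_mul_of_one_le_of_one_le hC1 hk1
  calc √(2 * B * k) * (c * ((d : ℝ) / m) ^ (1 / 2 : ℝ)) ^ (1 / 2 : ℝ)
      = √(2 * B * k) * (√c * ((d : ℝ) / m) ^ (1 / 4 : ℝ)) := by
        rw [Real.mul_rpow hc.le (by positivity), ← Real.rpow_mul (by positivity),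
          ← Real.sqrt_eq_rpow]
        norm_num
    _ ≤ √(2 * B * k) * (√c * (√3 * ((d : ℝ) / n) ^ (1 / 4 : ℝ))) := by
        gcongr
        calc ((d : ℝ) / m) ^ (1 / 4 : ℝ) ≤ (3 * (d / n)) ^ (1 / 4 : ℝ) :=
              Real.rpow_le_rpow (by positivity) hdm (by norm_num)
          _ = 3 ^ (1 / 4 : ℝ) * ((d : ℝ) / n) ^ (1 / 4 : ℝ) :=
              Real.mul_rpow (by norm_num) (by positivity)
          _ ≤ _ := by gcongr
    _ = √(2 * B * k * 3) * √c * ((d : ℝ) / n) ^ (1 / 4 : ℝ) := by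
        rw [Real.sqrt_mul (by positivity : 0 ≤ 2 * B * k) 3]; ring
    _ ≤ _ := by
        gcongr
        calc √(2 * B * k * 3) ≤ √(C * k) := by
              refine Real.sqrt_le_sqrt ?_
              nlinarith
          _ = (C * k) ^ (1 / 2 : ℝ) := Real.sqrt_eq_rpow _
          _ ≤ _ := Real.rpow_le_rpow_of_exponent_le hCk (by linarith)

/-- The fifth power of `k` is `k⁴ · √k · √k`: one root from the random direction, the other from `r
^ q` with `q ≤ 1/2`. -/
theorem stage_two_rate_le {r : ℕ} (hk : 0 < k) (hr : r ≤ k) (hm : 0 < m) (hn : 0 < n)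
    (hmn : n ≤ 3 * m) (hc : 0 < c) {A B : ℝ} (hA : 0 ≤ A) (hB : 1 ≤ B) (hC : 96 * A * B ≤ C) :
    32 * k ^ 4 * √r * A * B ^ (1 / (2 * (k : ℝ) - 1))
        * (c * ((r : ℝ) / m) ^ (1 / 2 : ℝ)) ^ (1 / (2 * (k : ℝ) - 1))
      ≤ C * (k : ℝ) ^ 5 * c ^ (1 / (2 * (k : ℝ) - 1)) * (1 / (n : ℝ)) ^ (1 / (4 * (k : ℝ) - 2)) := by
  have hk1 : (1 : ℝ) ≤ k := by exact_mod_cast hk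
  have hr' : (r : ℝ) ≤ k := by exact_mod_cast hr
  have hm' : (0 : ℝ) < m := by exact_mod_cast hm
  have hn' : (0 : ℝ) < n := by exact_mod_cast hn
  have hmn' : (n : ℝ) ≤ 3 * m := by exact_mod_cast hmn
  set p := 1 / (2 * (k : ℝ) - 1) with hp
  set q := 1 / (4 * (k : ℝ) - 2) with hq
  have hp1 : p ≤ 1 := by rw [hp, div_le_one] <;> linarith
  have hq0 : 0 ≤ q := by apply div_nonneg <;> linarith
  have hq1 : q ≤ 1 / 2 := by
    rw [hq, div_le_div_iff₀] <;> linarith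
  have hpq : 1 / 2 * p = q := by
    rw [hp, hq]
    have : 2 * (k : ℝ) - 1 ≠ 0 := by linarith
    rw [show 4 * (k : ℝ) - 2 = 2 * (2 * k - 1) by ring]
    field_simp
  have hrm : (r : ℝ) / m ≤ 3 * (k * (1 / n)) := by
    rw [mul_one_div, ← mul_div_assoc, div_le_div_iff₀ hm' hn']
    nlinarith [(Nat.cast_nonneg r : (0 : ℝ) ≤ r)]
  have h1 : ((r : ℝ) / m) ^ q ≤ 3 * (√k * (1 / (n : ℝ)) ^ q) := by
    calc ((r : ℝ) / m) ^ q ≤ (3 * (k * (1 / n))) ^ q := Real.rpow_le_rpow (by positivity) hrm hq0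
      _ = 3 ^ q * ((k : ℝ) ^ q * (1 / (n : ℝ)) ^ q) := by
          rw [Real.mul_rpow (by norm_num) (by positivity), Real.mul_rpow (by positivity)
            (by positivity)]
      _ ≤ 3 * (√k * (1 / (n : ℝ)) ^ q) := by
          gcongr
          · calc (3 : ℝ) ^ q ≤ 3 ^ (1 : ℝ) :=
                  Real.rpow_le_rpow_of_exponent_le (by norm_num) (by linarith)
              _ = 3 := Real.rpow_one 3
          · rw [Real.sqrt_eq_rpow]
            exact Real.rpow_le_rpow_of_exponent_le hk1 hq1
  have h2 : B ^ p ≤ B := by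
    calc B ^ p ≤ B ^ (1 : ℝ) := Real.rpow_le_rpow_of_exponent_le hB hp1
      _ = B := Real.rpow_one B
  have hB0 : 0 ≤ B := by linarith
  calc 32 * k ^ 4 * √r * A * B ^ p * (c * ((r : ℝ) / m) ^ (1 / 2 : ℝ)) ^ p
      = 32 * k ^ 4 * √r * A * B ^ p * (c ^ p * ((r : ℝ) / m) ^ q) := by
        rw [Real.mul_rpow hc.le (by positivity), ← Real.rpow_mul (by positivity), hpq]
    _ ≤ 32 * k ^ 4 * √k * A * B * (c ^ p * (3 * (√k * (1 / (n : ℝ)) ^ q))) := by gcongr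
    _ = 96 * A * B * (k ^ 4 * (√k * √k)) * c ^ p * (1 / (n : ℝ)) ^ q := by ring
    _ = 96 * A * B * k ^ 5 * c ^ p * (1 / (n : ℝ)) ^ q := by
        rw [Real.mul_self_sqrt (by positivity)]; ring
    _ ≤ _ := by gcongr

/-- The exponent of `c` lies in `(0, 1]`, so its power is at least `min c₀ 1` for every `k`; hence
`C` need not depend on `k`. -/
theorem le_mixingRate_one (hk : 0 < k) {c₀ : ℝ} (hc₀ : 0 < c₀) (hcc : c₀ ≤ c) (hR : 0 ≤ R)
    (hC : R / min c₀ 1 ≤ C) : R ≤ mixingRate C c k d 1 := by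
  have hk1 : (1 : ℝ) ≤ k := by exact_mod_cast hk
  have hmin : 0 < min c₀ 1 := lt_min hc₀ one_pos
  have hC0 : 0 ≤ C := le_trans (by positivity) hC
  set p := 1 / (2 * (k : ℝ) - 1) with hp
  have hp0 : 0 ≤ p := by apply div_nonneg <;> linarith
  have hp1 : p ≤ 1 := by rw [hp, div_le_one] <;> linarith
  have h1 : min c₀ 1 ≤ c ^ p := by
    calc min c₀ 1 = (min c₀ 1) ^ (1 : ℝ) := (Real.rpow_one _).symm
      _ ≤ (min c₀ 1) ^ p := Real.rpow_le_rpow_of_exponent_ge hmin (min_le_right _ _) hp1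
      _ ≤ c ^ p := Real.rpow_le_rpow hmin.le ((min_le_left _ _).trans hcc) hp0
  rw [mixingRate]
  calc R ≤ C * min c₀ 1 := (div_le_iff₀ hmin).1 hC
    _ ≤ C * c ^ p := by gcongr
    _ ≤ C * (k : ℝ) ^ 5 * c ^ p := by
        have : C ≤ C * (k : ℝ) ^ 5 := le_mul_of_one_le_right hC0 (one_le_pow₀ hk1)
        have h0 : 0 ≤ c ^ p := hmin.le.trans h1
        gcongr
    _ ≤ _ := by
        simp only [Nat.cast_one, div_one, Real.one_rpow, mul_one]
        have : 0 ≤ (C * k) ^ ((k : ℝ) / 2) * √c * (d : ℝ) ^ (1 / 4 : ℝ) := by positivity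
        linarith

end Rate

/-! ### Assembly -/

/-- The two-stage estimator attains the rate, up to the choice of the constant. -/
theorem exists_twoStage_estimator_hasW1Risk {k d m N n : ℕ} (hk : 0 < k) (hd : 0 < d) (hm : 0 < m)
    (hn : 0 < n) (hmn : n ≤ 3 * m) (h : 2 * m ≤ N) {R c C : ℝ} (hR : 0 ≤ R) (hc : 0 < c)
    (hC1 : 6 * (2 * Real.exp (R + 1 / 2)) ≤ C)
    (hC2 : 96 * (Real.exp R * (1 + Real.exp R)) * (2 * Real.exp (R + 1 / 2)) ≤ C)
    (F : (d' : ℕ) → (Fin m → Euc d') → Measure (Euc d'))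
    (hF : ∀ d', 1 ≤ d' → IsProperDensityEstimator k d' m R c (F d')) :
    ∃ G : (Fin N → Euc d) → Measure (Euc d), IsMixingEstimator k d N R G ∧ IsTwoStage k h F G ∧
      HasW1Risk k d N R (mixingRate C c k d n) G := by
  obtain ⟨G, hG, hG2, hrisk⟩ := exists_twoStage_estimator hk hd h hR F hF
  refine ⟨G, hG, hG2, fun Γ hΓ => (hrisk Γ hΓ).trans ?_⟩
  have hk1 : (1 : ℝ) ≤ k := by exact_mod_cast hk
  have hp0 : 0 ≤ 1 / (2 * (k : ℝ) - 1) := by apply div_nonneg <;> linarith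
  have hB1 : 1 ≤ 2 * Real.exp (R + 1 / 2) := by
    have := Real.one_le_exp (x := R + 1 / 2) (by linarith)
    linarith
  rw [ENNReal.ofReal_rpow_of_nonneg (by positivity) (by norm_num),
    ENNReal.ofReal_rpow_of_nonneg (by positivity) hp0, ← ENNReal.ofReal_mul (by positivity),
    ← ENNReal.ofReal_mul (by positivity), ← ENNReal.ofReal_add (by positivity) (by positivity)]
  refine ENNReal.ofReal_le_ofReal (add_le_add ?_ ?_)
  · exact stage_one_rate_le hk hm hn hmn hc (by positivity) hC1 (by linarith)
  · exact stage_two_rate_le hk (min_le_right _ _) hm hn hmn hc (by positivity) hB1 hC2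

theorem mainTheorem7 (R : ℝ) (hR : 0 < R) :
    ∃ C : ℝ, 0 < C ∧ ∀ (k : ℕ), 1 ≤ k → ∀ c : ℝ, 0 < c →
      -- a fixed `n`: density estimators from `n` observations, two-stage estimator from `2 n`
      (∀ n : ℕ, 1 ≤ n →
        ∀ F : (d : ℕ) → (Fin n → Euc d) → Measure (Euc d),
          (∀ d, 1 ≤ d → IsProperDensityEstimator k d n R c (F d)) →
          ∀ d, 1 ≤ d → ∃ G : (Fin (2 * n) → Euc d) → Measure (Euc d),
            IsMixingEstimator k d (2 * n) R G ∧
            IsTwoStage k (le_refl (2 * n)) F G ∧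
            HasW1Risk k d (2 * n) R (mixingRate C c k d n) G) ∧
      -- all `n`: density estimators from `n` observations, mixing estimator from `n` observations
      (∀ F : (n d : ℕ) → (Fin n → Euc d) → Measure (Euc d),
          (∀ n, 1 ≤ n → ∀ d, 1 ≤ d → IsProperDensityEstimator k d n R c (F n d)) →
          ∀ n, 1 ≤ n → ∀ d, 1 ≤ d → ∃ G : (Fin n → Euc d) → Measure (Euc d),
            IsMixingEstimator k d n R G ∧
            (2 ≤ n → IsTwoStage k (Nat.mul_div_le n 2) (F (n / 2)) G) ∧
            HasW1Risk k d n R (mixingRate C c k d n) G) := by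
  obtain ⟨c₀, hc₀, hlow⟩ := exists_pos_le_of_isProperDensityEstimator hR
  set C₁ := 6 * (2 * Real.exp (R + 1 / 2)) with hC₁
  set C₂ := 96 * (Real.exp R * (1 + Real.exp R)) * (2 * Real.exp (R + 1 / 2)) with hC₂
  have h1 : 0 < C₁ := by positivity
  have h2 : 0 < C₂ := by positivity
  have h3 : 0 ≤ R / min c₀ 1 := div_nonneg hR.le (lt_min hc₀ one_pos).le
  -- The summands serve the first stage, the second stage and the case `n = 1` of (b), respectively.
  refine ⟨C₁ + C₂ + R / min c₀ 1, by positivity, fun k hk c hc => ⟨?_, ?_⟩⟩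
  · intro n hn F hF d hd
    exact exists_twoStage_estimator_hasW1Risk hk hd hn hn (by omega) (le_refl _) hR.le hc
      (by linarith) (by linarith) F hF
  · intro F hF n hn d hd
    rcases Nat.lt_or_ge n 2 with hn2 | hn2
    -- Half of one observation is none, so the point mass at the origin is used; its error is at
    -- most `R`.
    · obtain rfl : n = 1 := by omega
      refine ⟨fun _ => Measure.dirac 0, ⟨measurable_const, fun _ =>
        dirac_mem_atomicMixing hk (by simpa using hR.le)⟩, fun h => absurd h (by omega),
        fun Γ hΓ => ?_⟩
      have := isProbabilityMeasure_of_mem_atomicMixing hΓ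
      have : IsProbabilityMeasure (sampleLaw 1 Γ) := by unfold sampleLaw; infer_instance
      rw [lintegral_const, measure_univ, mul_one]
      refine (wasserstein1_dirac_zero_le hΓ).trans (ENNReal.ofReal_le_ofReal ?_)
      exact le_mixingRate_one hk hc₀ (hlow k hk c _ (hF 1 le_rfl 1 le_rfl)) hR.le (by linarith)
    · obtain ⟨G, hG, hG2, hG3⟩ := exists_twoStage_estimator_hasW1Risk hk hd (m := n / 2) (n := n)
        (by omega) hn (by omega) (Nat.mul_div_le n 2) hR.le hc
        (C := C₁ + C₂ + R / min c₀ 1) (by linarith) (by linarith) (F (n / 2))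
        (hF (n / 2) (by omega))
      exact ⟨G, hG, fun _ => hG2, hG3⟩
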